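/- Let $X$ be a projective K3 surface over $\mathbb C$ (a smooth projective integral surface with $\omega_X\cong\mathcal O_X$ and $H^1(X,\mathcal O_X)=0$), let $N\ge 1$, and let $G=\mathbb Z/N\mathbb Z$ act faithfully on $X$ by automorphisms over $\mathbb C$. Let $\Delta_2=\operatorname{Spec}\mathbb C[[\tau]]$, on which the generator $1\in\mathbb Z/N\mathbb Z$ acts by $\tau\mapsto\zeta\tau$ with $\zeta=\exp(2\pi i/N)$, and let $\Delta_1=\Delta_2/G=\operatorname{Spec}\mathbb C[[t]]$ with $t=\tau^N$. Let $G$ act diagonally on $X\times\Delta_2$ (product over $\mathbb C$), let $$\pi:\mathcal X=(X\times\Delta_2)/G\to\Delta_1$$ be the morphism induced by the projection $X\times\Delta_2\to\Delta_2$, and let $\mathcal X_t=\mathcal X\times_{\Delta_1}\operatorname{Spec}K$ be its generic fibre, where $K=\mathbb C((t))$. Then $\pi$ admits a section if and only if the action of $G$ on $X$ has a fixed point, i.e. there is $x\in X(\mathbb C)$ with $g\cdot x=x$ for all $g\in G$. Equivalently, $\mathcal X_t$ has a $K$-rational point if and only if the action of $G$ on $X$ has a fixed point. -/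

import Mathlib

open CategoryTheory CategoryTheory.Limits AlgebraicGeometry

noncomputable section

namespace IsotrivialK3

/-! ### Complex K3 surfaces -/

/-- The category of schemes over `ℂ`. -/
abbrev ComplexScheme : Type 1 := Over (Spec (CommRingCat.of ℂ))

/-- Sections of the structure sheaf of a scheme over `ℂ` form a `ℂ`-algebra. -/
instance sectionsAlgebra (X : ComplexScheme) (U : X.left.Opens) : Algebra ℂ Γ(X.left, U) :=
  RingHom.toAlgebra
    ((Scheme.ΓSpecIso (CommRingCat.of ℂ)).inv ≫ X.hom.appLE ⊤ U (by simp)).hom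

/-- Projective space `ℙⁿ` over `ℂ`. -/
def projectiveSpace (n : ℕ) : ComplexScheme :=
  letI : GradedAlgebra (MvPolynomial.homogeneousSubmodule (Fin (n + 1)) ℂ) :=
    MvPolynomial.gradedAlgebra
  Over.mk (Proj.toSpecZero (MvPolynomial.homogeneousSubmodule (Fin (n + 1)) ℂ) ≫
    Spec.map (CommRingCat.ofHom
      (algebraMap ℂ (MvPolynomial.homogeneousSubmodule (Fin (n + 1)) ℂ 0))))

/-- The structure sheaf, as a sheaf of abelian groups. -/
def structureSheafAb (X : ComplexScheme) :
    Sheaf (Opens.grothendieckTopology X.left) AddCommGrpCat.{0} :=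
  (sheafCompose _ (forget₂ CommRingCat.{0} RingCat.{0} ⋙
    forget₂ RingCat.{0} AddCommGrpCat.{0})).obj X.left.sheaf

/-- For a homomorphism of `ℂ`-algebras `A → B`, the induced map
`⋀²_A Ω_{A/ℂ} → ⋀²_B Ω_{B/ℂ}`, `da ∧ db ↦ da ∧ db`. -/
def twoFormMap (A B : Type) [CommRing A] [CommRing B] [Algebra ℂ A] [Algebra ℂ B]
    (f : A →ₐ[ℂ] B) :
    (⋀[A]^2 (Ω[A⁄ℂ])) → (⋀[B]^2 (Ω[B⁄ℂ])) :=
  letI : Algebra A B := f.toRingHom.toAlgebra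
  haveI : IsScalarTower ℂ A B := IsScalarTower.of_algebraMap_eq fun r => (f.commutes r).symm
  exteriorPower.alternatingMapLinearEquiv
    { ((exteriorPower.ιMulti B 2 (M := Ω[B⁄ℂ])).toMultilinearMap.restrictScalars A).compLinearMap
        fun _ => KaehlerDifferential.map ℂ ℂ A B with
      map_eq_zero_of_eq' := fun v _ _ h hij =>
        (exteriorPower.ιMulti B 2 (M := Ω[B⁄ℂ])).map_eq_zero_of_eq
          (fun k => KaehlerDifferential.map ℂ ℂ A B (v k))
          (congrArg (KaehlerDifferential.map ℂ ℂ A B) h) hij }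

/-- Restriction of functions, as a `ℂ`-algebra homomorphism. -/
def restrict (X : ComplexScheme) {U V : X.left.Opens} (h : U ≤ V) :
    Γ(X.left, V) →ₐ[ℂ] Γ(X.left, U) where
  __ := (X.left.presheaf.map (homOfLE h).op).hom
  commutes' r := by
    have key := Scheme.Hom.appLE_map X.hom (U := ⊤) (V := V) (by simp) (homOfLE h).op
    exact congrArg
      (fun k => ((Scheme.ΓSpecIso (CommRingCat.of ℂ)).inv ≫ k).hom r) key

/-- `ω_X ≅ 𝒪_X` for a smooth surface `X` over `ℂ`: there is a global section of the canonical sheaf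
`ω_X = ⋀² Ω_{X/ℂ}`, i.e. a compatible family of sections over the affine open subsets, such that
multiplication by it is an isomorphism `𝒪_X → ω_X`. -/
def HasTrivialCanonicalSheaf (X : ComplexScheme) : Prop :=
  ∃ ω : ∀ U : X.left.affineOpens, ⋀[Γ(X.left, U.1)]^2 (Ω[Γ(X.left, U.1)⁄ℂ]),
    (∀ (U V : X.left.affineOpens) (h : U.1 ≤ V.1),
      twoFormMap Γ(X.left, V.1) Γ(X.left, U.1) (restrict X h) (ω V) = ω U) ∧
    ∀ U : X.left.affineOpens, Function.Bijective fun a : Γ(X.left, U.1) => a • ω U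

/-- `X` is a projective K3 surface over `ℂ`: a smooth projective integral surface with
`ω_X ≅ 𝒪_X` and `H¹(X, 𝒪_X) = 0`. -/
structure IsProjectiveK3Surface (X : ComplexScheme) : Prop where
  projective : ∃ (n : ℕ) (i : X ⟶ projectiveSpace n), IsClosedImmersion i.left
  smooth : SmoothOfRelativeDimension 2 X.hom
  integral : IsIntegral X.left
  trivial_canonical : HasTrivialCanonicalSheaf X
  irregularity : Subsingleton (Sheaf.H (structureSheafAb X) 1)

/-- The action `φ` of `G` on `X` has a fixed point: a complex point of `X` fixed by all of `G`. -/
def HasFixedPoint {G : Type} [Group G] {X : ComplexScheme} (φ : G →* Aut X) : Prop :=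
  ∃ x : Over.mk (𝟙 (Spec (CommRingCat.of ℂ))) ⟶ X, ∀ g : G, x ≫ (φ g).hom = x

/-! ### Quotients -/

/-- The quotient `Y / G` of a locally ringed space by a group: the topological quotient, with the
`G`-invariant functions as structure sheaf. It is the colimit of the action, viewed as a functor
on the one-object category of `G`. For finite `G` and a scheme `Y` in which each orbit lies in
an affine open set it is the usual quotient scheme. -/
def orbitSpace {G : Type} [Group G] {Y : LocallyRingedSpace.{0}} (ρ : G →* End Y) :
    LocallyRingedSpace.{0} :=
  colimit (SingleObj.functor ρ)

/-- The morphism `Y / G ⟶ Z` induced by a `G`-invariant morphism `Y ⟶ Z`. -/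
def orbitSpaceDesc {G : Type} [Group G] {Y Z : LocallyRingedSpace.{0}} (ρ : G →* End Y)
    (f : Y ⟶ Z) (hf : ∀ g : G, ρ g ≫ f = f) : orbitSpace ρ ⟶ Z :=
  colimit.desc (SingleObj.functor ρ)
    { pt := Z
      ι := { app := fun _ => f
             naturality := fun _ _ g => (hf g).trans (Category.comp_id f).symm } }

/-! ### The isotrivial family -/

/-- The formal disc `Spec ℂ⟦τ⟧`. -/
abbrev disc : Scheme.{0} := Spec (CommRingCat.of (PowerSeries ℂ))

/-- The structure morphism `Spec ℂ⟦τ⟧ ⟶ Spec ℂ`. -/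
def discToPoint : disc ⟶ Spec (CommRingCat.of ℂ) :=
  Spec.map (CommRingCat.ofHom (algebraMap ℂ (PowerSeries ℂ)))

variable (N : ℕ) [NeZero N]

/-- The group `ℤ/Nℤ`, written multiplicatively. -/
abbrev CyclicGroup : Type := Multiplicative (ZMod N)

/-- The action of `g ∈ ℤ/Nℤ` on `Δ₂`: `τ ↦ ζ ^ g τ` with `ζ = exp (2πi / N)`. -/
def discRotation (g : CyclicGroup N) : disc ⟶ disc :=
  Spec.map (CommRingCat.ofHom (PowerSeries.rescale (ZMod.stdAddChar g.toAdd)))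

/-- The quotient map `Δ₂ = Spec ℂ⟦τ⟧ ⟶ Δ₁ = Spec ℂ⟦t⟧`, `t ↦ τ ^ N`. -/
def discQuotient : disc ⟶ disc :=
  Spec.map (CommRingCat.ofHom (PowerSeries.expand (R := ℂ) N (NeZero.ne N)).toRingHom)

theorem rescale_expand (g : ZMod N) (h : PowerSeries ℂ) :
    PowerSeries.rescale (ZMod.stdAddChar g) (PowerSeries.expand (R := ℂ) N (NeZero.ne N) h) =
      PowerSeries.expand (R := ℂ) N (NeZero.ne N) h := by
  ext n
  rw [PowerSeries.coeff_rescale]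
  by_cases hn : N ∣ n
  · obtain ⟨m, rfl⟩ := hn
    rw [pow_mul, ← AddChar.map_nsmul_eq_pow, nsmul_eq_mul, CharP.cast_eq_zero, zero_mul,
      AddChar.map_zero_eq_one, one_pow, one_mul]
  · rw [PowerSeries.coeff_expand_of_not_dvd _ _ _ hn, mul_zero]

/-- The `G`-invariant functions on `Δ₂` are exactly the power series in `t = τ ^ N`, so that
`discQuotient` is the quotient of `Δ₂` by `G`. -/
theorem mem_range_expand_iff (f : PowerSeries ℂ) :
    (∃ h, PowerSeries.expand (R := ℂ) N (NeZero.ne N) h = f) ↔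
      ∀ g : ZMod N, PowerSeries.rescale (ZMod.stdAddChar g) f = f := by
  constructor
  · rintro ⟨h, rfl⟩ g
    exact rescale_expand N g h
  · intro hf
    refine ⟨PowerSeries.mk fun n => PowerSeries.coeff (N * n) f, ?_⟩
    ext n
    by_cases hn : N ∣ n
    · obtain ⟨m, rfl⟩ := hn
      rw [PowerSeries.coeff_expand_mul, PowerSeries.coeff_mk]
    · rw [PowerSeries.coeff_expand_of_not_dvd _ _ _ hn]
      by_contra h0
      have h1 := congrArg (PowerSeries.coeff n) (hf 1)
      rw [PowerSeries.coeff_rescale] at h1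
      have h2 : (ZMod.stdAddChar (1 : ZMod N) : ℂ) ^ n = 1 :=
        mul_right_cancel₀ (Ne.symm h0) (by rw [h1, one_mul])
      rw [← AddChar.map_nsmul_eq_pow, nsmul_eq_mul, mul_one,
        ← AddChar.map_zero_eq_one (ZMod.stdAddChar (N := N))] at h2
      exact hn ((ZMod.natCast_eq_zero_iff n N).mp (ZMod.injective_stdAddChar h2))

theorem discRotation_one : discRotation N 1 = 𝟙 disc := by
  simp only [discRotation, toAdd_one, AddChar.map_zero_eq_one, PowerSeries.rescale_one]
  exact Spec.map_id _

theorem discRotation_mul (g h : CyclicGroup N) :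
    discRotation N (g * h) = discRotation N h ≫ discRotation N g := by
  simp only [discRotation]
  rw [← Spec.map_comp, ← CommRingCat.ofHom_comp, ← PowerSeries.rescale_mul, mul_comm, toAdd_mul,
    AddChar.map_add_eq_mul, mul_comm]

theorem discRotation_discToPoint (g : CyclicGroup N) :
    discRotation N g ≫ discToPoint = discToPoint := by
  simp only [discRotation, discToPoint]
  rw [← Spec.map_comp, ← CommRingCat.ofHom_comp]
  congr 2
  ext c n
  simp only [RingHom.comp_apply, PowerSeries.algebraMap_apply, PowerSeries.coeff_rescale,
    Algebra.algebraMap_self, RingHom.id_apply, PowerSeries.coeff_C]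
  split_ifs with h <;> simp [h]

theorem discRotation_discQuotient (g : CyclicGroup N) :
    discRotation N g ≫ discQuotient N = discQuotient N := by
  simp only [discRotation, discQuotient]
  rw [← Spec.map_comp, ← CommRingCat.ofHom_comp]
  congr 2
  exact RingHom.ext fun h => rescale_expand N _ h

variable {N} {X : ComplexScheme} (φ : CyclicGroup N →* Aut X)

/-- `X × Δ₂`, the product over `ℂ`. -/
abbrev productWithDisc (X : ComplexScheme) : Scheme.{0} := pullback X.hom discToPoint

/-- The diagonal action on `X × Δ₂` of an element of `G`. -/
def diagonalMap (g : CyclicGroup N) : productWithDisc X ⟶ productWithDisc X :=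
  pullback.lift (pullback.fst X.hom discToPoint ≫ (φ g).hom.left)
    (pullback.snd X.hom discToPoint ≫ discRotation N g)
    (by rw [Category.assoc, Over.w, Category.assoc, discRotation_discToPoint, pullback.condition])

theorem diagonalMap_one : diagonalMap φ 1 = 𝟙 _ := by
  apply pullback.hom_ext
  · rw [diagonalMap, pullback.lift_fst, map_one, Category.id_comp]
    exact Category.comp_id _
  · rw [diagonalMap, pullback.lift_snd, discRotation_one, Category.id_comp, Category.comp_id]

theorem diagonalMap_mul (g h : CyclicGroup N) :
    diagonalMap φ (g * h) = diagonalMap φ h ≫ diagonalMap φ g := by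
  apply pullback.hom_ext
  · simp only [diagonalMap]
    rw [pullback.lift_fst, Category.assoc, pullback.lift_fst, pullback.lift_fst_assoc, map_mul,
      Category.assoc]
    rfl
  · simp only [diagonalMap]
    rw [pullback.lift_snd, Category.assoc, pullback.lift_snd, pullback.lift_snd_assoc,
      discRotation_mul, Category.assoc]

/-- The diagonal action of `G` on `X × Δ₂`. -/
def diagonalAction : CyclicGroup N →* End (productWithDisc X).toLocallyRingedSpace where
  toFun g := (diagonalMap φ g).toLRSHom
  map_one' := by
    rw [diagonalMap_one]
    rfl
  map_mul' g h := by
    rw [diagonalMap_mul]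
    rfl

/-- The total space `𝒳 = (X × Δ₂) / G`. -/
def totalSpace : LocallyRingedSpace.{0} := orbitSpace (diagonalAction φ)

/-- `Δ₁ = Δ₂ / G = Spec ℂ⟦t⟧`, as a locally ringed space. -/
abbrev base : LocallyRingedSpace.{0} := disc.toLocallyRingedSpace

/-- The family `π : 𝒳 ⟶ Δ₁` induced by the projection `X × Δ₂ ⟶ Δ₂`. -/
def familyMap : totalSpace φ ⟶ base :=
  orbitSpaceDesc (diagonalAction φ)
    (pullback.snd X.hom discToPoint ≫ discQuotient N).toLRSHom
    fun g => congrArg Scheme.Hom.toLRSHom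
      (show diagonalMap φ g ≫ pullback.snd X.hom discToPoint ≫ discQuotient N =
          pullback.snd X.hom discToPoint ≫ discQuotient N by
        rw [diagonalMap, pullback.lift_snd_assoc, Category.assoc, discRotation_discQuotient])

/-- The spectrum of `K = ℂ((t))`. -/
abbrev genericPoint : Scheme.{0} := Spec (CommRingCat.of (LaurentSeries ℂ))

/-- The inclusion `Spec K ⟶ Δ₁` of the generic point. -/
def genericInclusion : genericPoint ⟶ disc :=
  Spec.map (CommRingCat.ofHom (algebraMap (PowerSeries ℂ) (LaurentSeries ℂ)))

instance : IsOpenImmersion genericInclusion :=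
  IsOpenImmersion.of_isLocalization (PowerSeries.X : PowerSeries ℂ)

/-- The inclusion of the generic point, as a morphism of locally ringed spaces. -/
def genericInclusionLRS : genericPoint.toLocallyRingedSpace ⟶ base :=
  genericInclusion.toLRSHom

instance : LocallyRingedSpace.IsOpenImmersion genericInclusionLRS :=
  inferInstanceAs (IsOpenImmersion genericInclusion)

/-- The generic fibre `𝒳_t = 𝒳 ×_{Δ₁} Spec K`. -/
def genericFibre : LocallyRingedSpace.{0} := pullback (familyMap φ) genericInclusionLRS

/-- The structure morphism `𝒳_t ⟶ Spec K`. -/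
def genericFibreMap : genericFibre φ ⟶ genericPoint.toLocallyRingedSpace :=
  pullback.snd (familyMap φ) genericInclusionLRS

/-- The family `π : 𝒳 ⟶ Δ₁` admits a section. -/
def HasSection : Prop := ∃ s : base ⟶ totalSpace φ, s ≫ familyMap φ = 𝟙 base

/-- The generic fibre `𝒳_t` has a `K`-rational point. -/
def HasRationalPoint : Prop :=
  ∃ p : genericPoint.toLocallyRingedSpace ⟶ genericFibre φ, p ≫ genericFibreMap φ = 𝟙 _

end IsotrivialK3

end

/-! A fixed point x gives the constant equivariant section (x, id) : Δ₂ → X × Δ₂. It descends to the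
quotients, and Δ₂/G, formed as a colimit, is Δ₁ (`discOrbitMap` is an isomorphism), so π has a
section; restricting a section to Spec K gives a rational point. What remains is to pass from a
rational point to a fixed point.

A K-point of 𝒳 lies in the image of U × Δ₂ for some G-stable affine open U of X: by projectivity an
orbit lies in an affine open, and the translates can be intersected (`exists_stable_nhd`). Functions
on this image are the invariants B^G of B = Γ(U × Δ₂) (`orbitMap_sections`), so the point becomes a
homomorphism χ : B^G → ℂ((t)) over ℂ⟦t⟧ (`exists_evaluation`).

The function τ in B is an eigenvector for a faithful character of G, and τ^N = t goes to a nonzero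
element. By Kummer theory χ therefore extends to B → ℂ((τ)) with τ ↦ τ (`exists_extend`), and such
an extension is unique (`extend_unique`). Uniqueness makes it equivariant (`exists_equivariant`).
Restricting it to Γ(U) gives an equivariant morphism Spec ℂ((τ)) → X.

As X is proper, the valuative criterion extends this morphism to Δ₂ → X, and its uniqueness part
keeps the extension equivariant. Rotations fix the closed point of Δ₂, so G fixes the image of that
point (`hasFixedPoint_of_equivariant`). -/

noncomputable section

namespace IsotrivialK3
open Opposite TopologicalSpace

/-! ### Quotients of ringed spaces by a group -/

section Presheafed

variable {G : Type} [Group G] {F : SingleObj G ⥤ PresheafedSpace.{0, 1, 0} CommRingCat.{0}}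

/-- The sections of a quotient are the invariant sections upstairs. -/
def SectionsAreInvariants (c : Cocone F) : Prop :=
  ∀ U : Opens c.pt,
    Function.Injective ((c.ι.app (SingleObj.star G)).c.app (op U)).hom ∧
    ∀ s : (F.obj (SingleObj.star G)).presheaf.obj
        (op ((Opens.map (c.ι.app (SingleObj.star G)).base).obj U)),
      (∀ (g : G) (h : (Opens.map (c.ι.app (SingleObj.star G)).base).obj U ≤
          (Opens.map (F.map (X := SingleObj.star G) (Y := SingleObj.star G) g).base).obj
            ((Opens.map (c.ι.app (SingleObj.star G)).base).obj U)),
        ((F.obj (SingleObj.star G)).presheaf.map (homOfLE h).op).hom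
          (((F.map (X := SingleObj.star G) (Y := SingleObj.star G) g).c.app _).hom s) = s) →
      ∃ t, ((c.ι.app (SingleObj.star G)).c.app (op U)).hom t = s

/-- Sections of a colimit of presheafed spaces form the limit of the sections over preimages; over a
one-object category a compatible family is a single invariant section. -/
theorem sectionsAreInvariants_colimit : SectionsAreInvariants (colimit.cocone F) := by
  intro U
  constructor
  · intro a b h
    apply (ConcreteCategory.bijective_of_isIso
      (PresheafedSpace.colimitPresheafObjIsoComponentwiseLimit F U).hom).1
    apply Concrete.limit_ext
    rintro ⟨j⟩
    have := PresheafedSpace.colimitPresheafObjIsoComponentwiseLimit_hom_π F U j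
    rw [← ConcreteCategory.comp_apply, ← ConcreteCategory.comp_apply]
    erw [this]
    exact h
  · intro s hs
    let D := PresheafedSpace.componentwiseDiagram F U
    have hl := isLimitOfPreserves (forget CommRingCat) (limit.isLimit D)
    let σ : (D ⋙ forget CommRingCat).sections := ⟨fun _ => s, by
      rintro ⟨j⟩ ⟨k⟩ ⟨g⟩
      refine Eq.trans ?_ (hs g ?_)
      rfl⟩
    refine ⟨(PresheafedSpace.colimitPresheafObjIsoComponentwiseLimit F U).inv.hom
      ((Types.isLimitEquivSections hl).symm σ), ?_⟩
    have := PresheafedSpace.colimitPresheafObjIsoComponentwiseLimit_inv_ι_app F U (SingleObj.star G)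
    exact (ConcreteCategory.congr_hom this _).trans
      (Types.isLimitEquivSections_symm_apply hl σ (op (SingleObj.star G)))

/-- Needed because the colimit of locally ringed spaces, once its underlying presheafed space is
taken, is a colimit cocone but not the chosen one. -/
theorem sectionsAreInvariants_of_isColimit {c : Cocone F} (hc : IsColimit c) :
    SectionsAreInvariants c := by
  obtain ⟨e⟩ : Nonempty (colimit.cocone F ≅ c) := ⟨(colimit.isColimit F).uniqueUpToIso hc⟩
  let e' : colimit F ≅ c.pt := (Cocone.forget _).mapIso e
  obtain ⟨f, hf, hi⟩ : ∃ (f : colimit F ⟶ c.pt),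
      colimit.ι F (SingleObj.star G) ≫ f = c.ι.app (SingleObj.star G) ∧ IsIso f :=
    ⟨e.hom.hom, e.hom.w _, inferInstanceAs (IsIso e'.hom)⟩
  unfold SectionsAreInvariants
  rw [← hf]
  intro U
  have h := sectionsAreInvariants_colimit (F := F) ((Opens.map f.base).obj U)
  have : IsIso f.c := PresheafedSpace.c_isIso_of_iso f
  have hb : Function.Bijective (f.c.app (op U)).hom :=
    ConcreteCategory.bijective_of_isIso (f.c.app (op U))
  constructor
  · exact h.1.comp hb.1
  · intro s hs
    obtain ⟨t, ht⟩ := h.2 s hs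
    obtain ⟨t', rfl⟩ := hb.2 t
    exact ⟨t', ht⟩

end Presheafed

section LocallyRinged

variable {G : Type} [Group G] {Y : LocallyRingedSpace.{0}} (ρ : G →* End Y)

/-- The quotient map `Y ⟶ Y / G`. -/
def orbitMap : Y ⟶ orbitSpace ρ :=
  colimit.ι (SingleObj.functor ρ) (SingleObj.star G)

theorem act_orbitMap (g : G) : (show Y ⟶ Y from ρ g) ≫ orbitMap ρ = orbitMap ρ :=
  colimit.w (SingleObj.functor ρ) (j := SingleObj.star G) (j' := SingleObj.star G) g

theorem orbitMap_desc {Z : LocallyRingedSpace.{0}} (f : Y ⟶ Z) (hf : ∀ g : G, ρ g ≫ f = f) :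
    orbitMap ρ ≫ orbitSpaceDesc ρ f hf = f :=
  colimit.ι_desc _ _

theorem orbitSpace_hom_ext {Z : LocallyRingedSpace.{0}} {f g : orbitSpace ρ ⟶ Z}
    (h : orbitMap ρ ≫ f = orbitMap ρ ≫ g) : f = g :=
  colimit.hom_ext fun _ => h

instance : PreservesColimitsOfSize.{0, 0} LocallyRingedSpace.forgetToTop.{0} :=
  inferInstanceAs (PreservesColimitsOfSize.{0, 0}
    (LocallyRingedSpace.forgetToSheafedSpace.{0} ⋙ SheafedSpace.forget CommRingCat.{0}))

theorem orbitMap_surjective : Function.Surjective (orbitMap ρ).base := by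
  intro q
  obtain ⟨_, y, hy⟩ := Concrete.isColimit_exists_rep
    (SingleObj.functor ρ ⋙ LocallyRingedSpace.forgetToTop)
    (isColimitOfPreserves LocallyRingedSpace.forgetToTop (colimit.isColimit (SingleObj.functor ρ))) q
  exact ⟨y, hy⟩

/-- A stable open set is the preimage of an open set of the quotient. -/
theorem exists_preimage_orbitMap (W : Opens Y)
    (hW : ∀ (g : G) (y : Y), (show Y ⟶ Y from ρ g).base y ∈ W ↔ y ∈ W) :
    ∃ V : Opens (orbitSpace ρ), (Opens.map (orbitMap ρ).base).obj V = W := by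
  have hc := isColimitOfPreserves LocallyRingedSpace.forgetToTop
    (colimit.isColimit (SingleObj.functor ρ))
  -- Open sets are continuous maps to the Sierpiński space `Prop`; stability of W says that its map
  -- is invariant, so it factors through the colimit.
  let χ : Y.toTopCat ⟶ TopCat.of Prop :=
    TopCat.ofHom ⟨fun y => y ∈ W, isOpen_iff_continuous_mem.mp W.2⟩
  let c : Cocone (SingleObj.functor ρ ⋙ LocallyRingedSpace.forgetToTop) :=
    { pt := TopCat.of Prop
      ι := { app := fun _ => χ
             naturality := fun _ _ g => by
               ext y
               exact propext (hW g y) } }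
  have hd : (orbitMap ρ).base ≫ hc.desc c = χ := hc.fac c (SingleObj.star G)
  refine ⟨⟨{q | (hc.desc c).hom q}, isOpen_iff_continuous_mem.mpr (hc.desc c).hom.continuous⟩, ?_⟩
  ext y
  exact Iff.of_eq (congrArg (fun f => f.hom y) hd)

theorem orbitMap_sections (V : Opens (orbitSpace ρ)) :
    Function.Injective ((orbitMap ρ).c.app (op V)).hom ∧
    ∀ s : Y.presheaf.obj (op ((Opens.map (orbitMap ρ).base).obj V)),
      (∀ (g : G) (h : (Opens.map (orbitMap ρ).base).obj V ≤
          (Opens.map (show Y ⟶ Y from ρ g).base).obj ((Opens.map (orbitMap ρ).base).obj V)),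
        (Y.presheaf.map (homOfLE h).op).hom
          (((show Y ⟶ Y from ρ g).c.app _).hom s) = s) →
      ∃ t, ((orbitMap ρ).c.app (op V)).hom t = s :=
  sectionsAreInvariants_of_isColimit (isColimitOfPreserves
    (LocallyRingedSpace.forgetToSheafedSpace ⋙ SheafedSpace.forgetToPresheafedSpace)
    (colimit.isColimit (SingleObj.functor ρ))) V

theorem map_app_of_eq {Z : LocallyRingedSpace.{0}} {f f' : Y ⟶ Z} (hf : f = f') (V : Opens Z)
    (h : (Opens.map f'.base).obj V ≤ (Opens.map f.base).obj V) (t : Z.presheaf.obj (op V)) :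
    (Y.presheaf.map (homOfLE h).op).hom ((f.c.app (op V)).hom t) = (f'.c.app (op V)).hom t := by
  subst hf
  exact ConcreteCategory.congr_hom (Y.presheaf.map_id _) _

/-- Sections of Y/G and of Z are both identified with the same invariant functions on Y. -/
theorem orbitSpace_app_bijective {Z : LocallyRingedSpace.{0}} (κ : orbitSpace ρ ⟶ Z) (f : Y ⟶ Z)
    (hf : orbitMap ρ ≫ κ = f) (U : Opens Z) (hinj : Function.Injective (f.c.app (op U)).hom)
    (hsurj : ∀ s : Y.presheaf.obj (op ((Opens.map f.base).obj U)),
      (∀ (g : G) (h : (Opens.map f.base).obj U ≤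
          (Opens.map (show Y ⟶ Y from ρ g).base).obj ((Opens.map f.base).obj U)),
        (Y.presheaf.map (homOfLE h).op).hom
          (((show Y ⟶ Y from ρ g).c.app _).hom s) = s) →
      ∃ t, (f.c.app (op U)).hom t = s) :
    Function.Bijective (κ.c.app (op U)).hom := by
  subst hf
  refine ⟨fun a b h => hinj (congrArg
    ((orbitMap ρ).c.app (op ((Opens.map κ.base).obj U))).hom h), fun t => ?_⟩
  obtain ⟨a, ha⟩ := hsurj (((orbitMap ρ).c.app (op ((Opens.map κ.base).obj U))).hom t)
    fun g h => map_app_of_eq (act_orbitMap ρ g) ((Opens.map κ.base).obj U) h t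
  exact ⟨a, (orbitMap_sections ρ _).1 ha⟩

end LocallyRinged

/-! ### Pulling back functions along a morphism to an affine scheme -/

section PullbackFunctions

variable {T T' : Scheme.{0}} {R S : CommRingCat.{0}}

theorem le_preimage_top {T' : Scheme.{0}} (f : T ⟶ T') (W : T.Opens) : W ≤ f ⁻¹ᵁ ⊤ :=
  le_top

/-- The pullback of functions along a morphism to `Spec R`. -/
def pullFun (f : T ⟶ Spec R) (W : T.Opens) : R ⟶ Γ(T, W) :=
  (Scheme.ΓSpecIso R).inv ≫ f.appLE ⊤ W (le_preimage_top f W)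

theorem pullFun_appLE (f : T ⟶ Spec R) (h : T' ⟶ T) {W : T.Opens} {W' : T'.Opens}
    (e : W' ≤ h ⁻¹ᵁ W) : pullFun f W ≫ h.appLE W W' e = pullFun (h ≫ f) W' := by
  rw [pullFun, pullFun, Category.assoc, Scheme.Hom.appLE_comp_appLE]

theorem pullFun_app (f : T ⟶ Spec R) (h : T' ⟶ T) (W : T.Opens) :
    pullFun f W ≫ h.app W = pullFun (h ≫ f) (h ⁻¹ᵁ W) := by
  rw [← pullFun_appLE f h le_rfl, Scheme.Hom.app_eq_appLE]

theorem pullFun_specMap (f : T ⟶ Spec R) (φ : S ⟶ R) (W : T.Opens) :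
    pullFun (f ≫ Spec.map φ) W = φ ≫ pullFun f W := by
  rw [pullFun, pullFun, ← Category.assoc, Scheme.ΓSpecIso_inv_naturality, Category.assoc,
    ← Scheme.Hom.appLE_comp_appLE f (Spec.map φ) ⊤ ⊤ W (le_preimage_top _ _) (le_preimage_top _ _)]
  congr 2

theorem pullFun_id_eq_algebraMap (U : (Spec R).Opens) :
    (pullFun (𝟙 (Spec R)) U).hom = algebraMap R Γ(Spec R, U) := by
  rw [pullFun, Scheme.ΓSpecIso_inv]
  ext r
  simp
  rfl

theorem pullFun_specMap_app (φ : S ⟶ R) (U : (Spec S).Opens) (r : S) :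
    ((Spec.map φ).app U).hom (algebraMap S Γ(Spec S, U) r) =
      algebraMap R Γ(Spec R, Spec.map φ ⁻¹ᵁ U) (φ.hom r) := by
  rw [← pullFun_id_eq_algebraMap, ← pullFun_id_eq_algebraMap, ← CommRingCat.comp_apply,
    pullFun_app, Category.comp_id]
  have := pullFun_specMap (𝟙 _) φ (Spec.map φ ⁻¹ᵁ U)
  rw [Category.id_comp] at this
  rw [this]
  rfl

theorem specMap_appLE_algebraMap (φ : S ⟶ R) {U : (Spec S).Opens} {W : (Spec R).Opens}
    (e : W ≤ Spec.map φ ⁻¹ᵁ U) (r : S) :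
    ((Spec.map φ).appLE U W e).hom (algebraMap S Γ(Spec S, U) r) =
      algebraMap R Γ(Spec R, W) (φ.hom r) := by
  rw [← pullFun_id_eq_algebraMap, ← pullFun_id_eq_algebraMap, ← CommRingCat.comp_apply,
    pullFun_appLE, Category.comp_id]
  have := pullFun_specMap (𝟙 _) φ W
  rw [Category.id_comp] at this
  rw [this]
  rfl

end PullbackFunctions

/-! ### The disc modulo rotations -/

/-- The locus in the disc where a power series does not vanish. -/
def discBasicOpen (f : PowerSeries ℂ) : disc.Opens := PrimeSpectrum.basicOpen f

theorem discBasicOpen_zero : discBasicOpen 0 = ⊥ := PrimeSpectrum.basicOpen_zero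

theorem discBasicOpen_one : discBasicOpen 1 = ⊤ := PrimeSpectrum.basicOpen_one

/-- The spectrum of a discrete valuation ring has two points: a nonempty open set contains the
generic one, and it is everything once it contains the closed one. -/
theorem disc_opens (U : disc.Opens) : U = ⊥ ∨ U = ⊤ ∨
    U = discBasicOpen PowerSeries.X := by
  by_cases h0 : U = ⊥
  · exact .inl h0
  by_cases h1 : IsLocalRing.closedPoint (PowerSeries ℂ) ∈ U
  · exact .inr (.inl ((IsLocalRing.closed_point_mem_iff).mp h1))
  · refine .inr (.inr ?_)
    have hX (p : PrimeSpectrum (PowerSeries ℂ)) :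
        (PowerSeries.X : PowerSeries ℂ) ∉ p.asIdeal ↔ p = ⊥ := by
      refine ⟨fun h => ?_, by rintro rfl; exact PowerSeries.X_ne_zero⟩
      by_contra hp
      have hm := p.2.isMaximal fun h' => hp (PrimeSpectrum.ext h')
      rw [IsLocalRing.eq_maximalIdeal hm, PowerSeries.maximalIdeal_eq_span_X] at h
      exact h (Ideal.mem_span_singleton_self _)
    obtain ⟨q, hq⟩ : ∃ q, q ∈ U := by
      by_contra! h
      exact h0 (le_bot_iff.mp fun x hx => h x hx)
    have hbot : (⊥ : PrimeSpectrum (PowerSeries ℂ)) ∈ U :=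
      ((PrimeSpectrum.le_iff_specializes _ _).mp bot_le).mem_open U.2 hq
    ext p
    refine Iff.trans ?_ (hX p).symm
    refine ⟨fun h => ?_, by rintro rfl; exact hbot⟩
    by_contra hp
    have hm := p.2.isMaximal fun h' => hp (PrimeSpectrum.ext h')
    exact h1 (by rwa [show p = IsLocalRing.closedPoint _ from
      PrimeSpectrum.ext (IsLocalRing.eq_maximalIdeal hm)] at h)

theorem exists_eq_basicOpen_disc (U : disc.Opens) :
    ∃ f : PowerSeries ℂ, U = discBasicOpen f := by
  rcases disc_opens U with rfl | rfl | rfl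
  · exact ⟨0, discBasicOpen_zero.symm⟩
  · exact ⟨1, discBasicOpen_one.symm⟩
  · exact ⟨_, rfl⟩

theorem expand_injective (N : ℕ) [NeZero N] :
    Function.Injective (PowerSeries.expand (R := ℂ) N (NeZero.ne N)) := by
  intro f g h
  ext n
  have := congrArg (PowerSeries.coeff (N * n)) h
  rwa [PowerSeries.coeff_expand_mul, PowerSeries.coeff_expand_mul] at this

instance discSectionsAlgebra (U : disc.Opens) : Algebra (PowerSeries ℂ) Γ(disc, U) :=
  IsAffineOpen.instAlgebraCarrierObjOppositeOpensCarrierCarrierCommRingCatSpecPresheafOpOpens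
    (R := CommRingCat.of (PowerSeries ℂ)) (U := U)

instance isLocalization_disc_basicOpen (f : PowerSeries ℂ) :
    IsLocalization.Away f Γ(disc, discBasicOpen f) :=
  StructureSheaf.IsLocalization.to_basicOpen (CommRingCat.of (PowerSeries ℂ)) f

/-- On D(f) this compares the localization of ℂ⟦t⟧ at f with that of ℂ⟦τ⟧ at f(τ^N). The denominator
is invariant, so an invariant fraction has an invariant numerator, which is a series in τ^N. -/
theorem discQuotient_sections (N : ℕ) [NeZero N] (U : disc.Opens) :
    Function.Injective ((discQuotient N).app U).hom ∧
    ∀ s : Γ(disc, discQuotient N ⁻¹ᵁ U),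
      (∀ (g : CyclicGroup N) (h : discQuotient N ⁻¹ᵁ U ≤
          discRotation N g ⁻¹ᵁ (discQuotient N ⁻¹ᵁ U)),
        ((discRotation N g).appLE _ _ h).hom s = s) →
      ∃ t, ((discQuotient N).app U).hom t = s := by
  obtain ⟨f, rfl⟩ := exists_eq_basicOpen_disc U
  by_cases hf : f = 0
  · have h1 : Subsingleton Γ(disc, discBasicOpen f) := by
      subst hf
      rw [discBasicOpen_zero]
      exact CommRingCat.subsingleton_of_isTerminal disc.sheaf.isTerminalOfEmpty
    have h2 : Subsingleton Γ(disc, discQuotient N ⁻¹ᵁ discBasicOpen f) :=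
      ((discQuotient N).app (discBasicOpen f)).hom.codomain_trivial
    exact ⟨fun a b _ => Subsingleton.elim a b, fun s _ => ⟨0, Subsingleton.elim _ _⟩⟩
  let e := PowerSeries.expand (R := ℂ) N (NeZero.ne N)
  have he : Function.Injective e := expand_injective N
  have hef : e f ≠ 0 := fun h => hf (he (h.trans (map_zero e).symm))
  have hpow : Submonoid.powers (e f) ≤ nonZeroDivisors _ :=
    powers_le_nonZeroDivisors_of_noZeroDivisors hef
  have loc : IsLocalization.Away (e f) Γ(disc, discQuotient N ⁻¹ᵁ discBasicOpen f) :=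
    inferInstanceAs (IsLocalization.Away (e f) Γ(disc, discBasicOpen (e f)))
  have hinj : Function.Injective (algebraMap (PowerSeries ℂ)
      Γ(disc, discQuotient N ⁻¹ᵁ discBasicOpen f)) :=
    IsLocalization.injective _ hpow
  have happ (r : PowerSeries ℂ) : ((discQuotient N).app (discBasicOpen f)).hom
      (algebraMap _ _ r) = algebraMap (PowerSeries ℂ)
        Γ(disc, discQuotient N ⁻¹ᵁ discBasicOpen f) (e r) :=
    pullFun_specMap_app (CommRingCat.ofHom (PowerSeries.expand (R := ℂ) N (NeZero.ne N)).toRingHom)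
      (discBasicOpen f) r
  have hunit : IsUnit (algebraMap (PowerSeries ℂ) Γ(disc, discBasicOpen f) f) :=
    IsLocalization.Away.algebraMap_isUnit f
  have hunit' := IsLocalization.Away.algebraMap_isUnit (S :=
    Γ(disc, discQuotient N ⁻¹ᵁ discBasicOpen f)) (e f)
  constructor
  · rw [injective_iff_map_eq_zero]
    intro x hx
    obtain ⟨n, a, ha⟩ := IsLocalization.Away.surj f x
    have h := congrArg ((discQuotient N).app (discBasicOpen f)).hom ha
    rw [map_mul, hx, zero_mul, happ] at h
    have h' : a = 0 := he ((hinj (h.symm.trans (map_zero _).symm)).trans (map_zero e).symm)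
    rw [h', map_zero] at ha
    exact ((hunit.pow n).mul_left_eq_zero).mp ha
  · intro s hs
    obtain ⟨n, b, hb⟩ := IsLocalization.Away.surj (e f) s
    have hle (g : CyclicGroup N) : discQuotient N ⁻¹ᵁ discBasicOpen f ≤
        discRotation N g ⁻¹ᵁ (discQuotient N ⁻¹ᵁ discBasicOpen f) := by
      rw [← Scheme.Hom.comp_preimage, discRotation_discQuotient]
    have hrot (g : CyclicGroup N) (r : PowerSeries ℂ) :
        ((discRotation N g).appLE _ _ (hle g)).hom (algebraMap (PowerSeries ℂ)
          Γ(disc, discQuotient N ⁻¹ᵁ discBasicOpen f) r) = algebraMap (PowerSeries ℂ)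
          Γ(disc, discQuotient N ⁻¹ᵁ discBasicOpen f)
            (PowerSeries.rescale (ZMod.stdAddChar g.toAdd) r) :=
      specMap_appLE_algebraMap
        (CommRingCat.ofHom (PowerSeries.rescale (ZMod.stdAddChar g.toAdd))) (hle g) r
    obtain ⟨a, rfl⟩ := (mem_range_expand_iff N b).mpr fun g => by
      apply hinj
      have h := congrArg ((discRotation N (.ofAdd g)).appLE _ _ (hle (.ofAdd g))).hom hb
      rw [map_mul, map_pow, hs, hrot, hrot, toAdd_ofAdd, rescale_expand, hb] at h
      exact h.symm
    obtain ⟨u, hu⟩ := hunit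
    refine ⟨algebraMap _ _ a * (↑(u⁻¹ ^ n) : Γ(disc, discBasicOpen f)), ?_⟩
    apply (hunit'.pow n).mul_right_cancel
    rw [hb, ← happ, ← map_pow, ← map_mul, mul_assoc, ← hu, ← Units.val_pow_eq_pow_val,
      ← Units.val_mul, ← mul_pow, inv_mul_cancel, one_pow, Units.val_one, mul_one, happ]

section DiscQuotient

variable (N : ℕ) [NeZero N]

/-- The action of `ℤ/Nℤ` on the disc by rotations. -/
def discAction : CyclicGroup N →* End disc.toLocallyRingedSpace where
  toFun g := (discRotation N g).toLRSHom
  map_one' := by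
    rw [discRotation_one]
    rfl
  map_mul' g h := by
    rw [discRotation_mul]
    rfl

/-- The comparison map from the quotient of the disc by rotations to the disc. -/
def discOrbitMap : orbitSpace (discAction N) ⟶ base :=
  orbitSpaceDesc (discAction N) (discQuotient N).toLRSHom
    fun g => congrArg Scheme.Hom.toLRSHom (discRotation_discQuotient N g)

theorem orbitMap_discOrbitMap :
    orbitMap (discAction N) ≫ discOrbitMap N = (discQuotient N).toLRSHom :=
  orbitMap_desc _ _ _

theorem discQuotient_preimage (W : disc.Opens) : ∃ U : disc.Opens, discQuotient N ⁻¹ᵁ U = W := by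
  rcases disc_opens W with rfl | rfl | rfl
  · exact ⟨⊥, rfl⟩
  · exact ⟨⊤, rfl⟩
  · refine ⟨discBasicOpen PowerSeries.X, ?_⟩
    have : PowerSeries.expand (R := ℂ) N (NeZero.ne N) PowerSeries.X = PowerSeries.X ^ N :=
      PowerSeries.expand_X N (NeZero.ne N)
    refine Eq.trans (b := discBasicOpen (PowerSeries.expand (R := ℂ) N (NeZero.ne N)
      PowerSeries.X)) rfl ?_
    rw [this]
    exact PrimeSpectrum.basicOpen_pow _ _ (NeZero.pos N)

theorem discQuotient_surjective : Function.Surjective (discQuotient N) := by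
  intro x
  by_cases hx : x.asIdeal = ⊥
  · refine ⟨(⊥ : PrimeSpectrum (PowerSeries ℂ)), PrimeSpectrum.ext (Eq.trans ?_ hx.symm)⟩
    exact Ideal.comap_bot_of_injective
      (PowerSeries.expand (R := ℂ) N (NeZero.ne N)).toRingHom (expand_injective N)
  · refine ⟨IsLocalRing.closedPoint (PowerSeries ℂ), PrimeSpectrum.ext ?_⟩
    rw [IsLocalRing.eq_maximalIdeal (x.2.isMaximal hx)]
    let p : PrimeSpectrum (PowerSeries ℂ) := discQuotient N (IsLocalRing.closedPoint (PowerSeries ℂ))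
    refine IsLocalRing.eq_maximalIdeal (p.2.isMaximal fun h => PowerSeries.X_ne_zero (R := ℂ) ?_)
    have hm : PowerSeries.X ∈ p.asIdeal := by
      change PowerSeries.expand (R := ℂ) N (NeZero.ne N) PowerSeries.X ∈
        IsLocalRing.maximalIdeal (PowerSeries ℂ)
      rw [PowerSeries.expand_X N (NeZero.ne N), PowerSeries.maximalIdeal_eq_span_X]
      exact Ideal.mem_span_singleton.mpr (dvd_pow_self _ (NeZero.ne N))
    rw [h] at hm
    exact hm

theorem discOrbitMap_isHomeomorph : IsHomeomorph (discOrbitMap N).base := by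
  have hfac (y : disc) : (discOrbitMap N).base ((orbitMap (discAction N)).base y) =
      discQuotient N y :=
    congrArg (fun f => f.base y) (orbitMap_discOrbitMap N)
  have hs : Function.Surjective (discOrbitMap N).base := fun x => by
    obtain ⟨y, rfl⟩ := discQuotient_surjective N x
    exact ⟨_, hfac y⟩
  have hi : Function.Injective (discOrbitMap N).base := fun q q' h => by
    obtain ⟨y, rfl⟩ := orbitMap_surjective _ q
    obtain ⟨y', rfl⟩ := orbitMap_surjective _ q'
    rw [hfac, hfac] at h
    congr 1
    -- Every open set of Δ₂ is a preimage from Δ₁, so points with the same image are inseparable,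
    -- hence equal because the spectrum is T₀.
    refine (Inseparable.eq ?_)
    rw [inseparable_iff_forall_isOpen]
    intro W hW
    obtain ⟨U, hU⟩ := discQuotient_preimage N ⟨W, hW⟩
    have hm (z : disc) : z ∈ W ↔ discQuotient N z ∈ U :=
      Iff.of_eq (congrArg (z ∈ ·) hU.symm)
    rw [hm, hm, h]
  refine ⟨(discOrbitMap N).base.hom.continuous, ?_, hi, hs⟩
  intro V hV
  let V' : Opens (orbitSpace (discAction N)) := ⟨V, hV⟩
  obtain ⟨U, hU⟩ := discQuotient_preimage N ((Opens.map (orbitMap (discAction N)).base).obj V')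
  convert U.2
  ext x
  constructor
  · rintro ⟨q, hq, rfl⟩
    obtain ⟨y, rfl⟩ := orbitMap_surjective _ q
    rw [hfac]
    exact (Iff.of_eq (congrArg (y ∈ ·) hU)).mpr hq
  · intro hx
    obtain ⟨y, rfl⟩ := discQuotient_surjective N x
    exact ⟨_, (Iff.of_eq (congrArg (y ∈ ·) hU)).mp hx, hfac y⟩

theorem discOrbitMap_app_bijective (U : disc.Opens) :
    Function.Bijective ((discOrbitMap N).c.app (op U)).hom := by
  refine orbitSpace_app_bijective (discAction N) _ _ (orbitMap_discOrbitMap N) U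
    (discQuotient_sections N U).1 (discQuotient_sections N U).2

instance : IsIso (discOrbitMap N) := by
  have : IsIso (discOrbitMap N).base :=
    TopCat.isIso_iff_isHomeomorph _ |>.mpr (discOrbitMap_isHomeomorph N)
  have : IsIso (discOrbitMap N).c := by
    have (U : (Opens base)ᵒᵖ) : IsIso ((discOrbitMap N).c.app U) :=
      (ConcreteCategory.isIso_iff_bijective _).mpr (discOrbitMap_app_bijective N U.unop)
    exact NatIso.isIso_of_isIso_app _
  have h1 : IsIso (discOrbitMap N).toHom := PresheafedSpace.isIso_of_components _
  have h2 : IsIso ((LocallyRingedSpace.forgetToSheafedSpace ⋙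
    SheafedSpace.forgetToPresheafedSpace).map (discOrbitMap N)) := h1
  exact isIso_of_reflects_iso _ (LocallyRingedSpace.forgetToSheafedSpace ⋙
    SheafedSpace.forgetToPresheafedSpace)

end DiscQuotient

/-! ### From a fixed point to a section and a rational point -/

section FixedPointSection

variable {N : ℕ} [NeZero N] {X : ComplexScheme} (φ : CyclicGroup N →* Aut X)

/-- The quotient map `X × Δ₂ ⟶ 𝒳`. -/
def totalQuotient : (productWithDisc X).toLocallyRingedSpace ⟶ totalSpace φ :=
  orbitMap (diagonalAction φ)

theorem diagonalMap_totalQuotient (g : CyclicGroup N) :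
    (diagonalMap φ g).toLRSHom ≫ totalQuotient φ = totalQuotient φ :=
  act_orbitMap (diagonalAction φ) g

theorem totalQuotient_familyMap : totalQuotient φ ≫ familyMap φ =
    (pullback.snd X.hom discToPoint ≫ discQuotient N).toLRSHom :=
  orbitMap_desc _ _ _

theorem hasSection_of_hasFixedPoint (h : HasFixedPoint φ) : HasSection φ := by
  obtain ⟨x, hx⟩ := h
  -- The constant section at x; it commutes with the two actions because x is fixed.
  let σ : disc ⟶ productWithDisc X := pullback.lift (discToPoint ≫ x.left) (𝟙 disc) (by
    rw [Category.assoc, Over.w x, Category.id_comp]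
    exact Category.comp_id _)
  have hσ (g : CyclicGroup N) : discRotation N g ≫ σ = σ ≫ diagonalMap φ g := by
    have hg : x.left ≫ (φ g).hom.left = x.left := congrArg (fun k => k.left) (hx g)
    apply pullback.hom_ext
    · rw [diagonalMap, Category.assoc, Category.assoc, pullback.lift_fst, pullback.lift_fst,
        pullback.lift_fst_assoc, Category.assoc, hg, ← Category.assoc, discRotation_discToPoint]
    · rw [diagonalMap, Category.assoc, Category.assoc, pullback.lift_snd, pullback.lift_snd,
        pullback.lift_snd_assoc, Category.id_comp, Category.comp_id]
  let s : orbitSpace (discAction N) ⟶ totalSpace φ :=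
    orbitSpaceDesc (discAction N) (σ.toLRSHom ≫ totalQuotient φ) fun g => by
      have h1 : (discRotation N g).toLRSHom ≫ σ.toLRSHom = σ.toLRSHom ≫ (diagonalMap φ g).toLRSHom :=
        congrArg Scheme.Hom.toLRSHom (hσ g)
      change (discRotation N g).toLRSHom ≫ σ.toLRSHom ≫ _ = _
      rw [← Category.assoc, h1, Category.assoc, diagonalMap_totalQuotient]
  have hs : s ≫ familyMap φ = discOrbitMap N := by
    apply orbitSpace_hom_ext
    rw [orbitMap_discOrbitMap, ← Category.assoc, orbitMap_desc, Category.assoc,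
      totalQuotient_familyMap]
    have : σ ≫ pullback.snd X.hom discToPoint ≫ discQuotient N = discQuotient N := by
      rw [pullback.lift_snd_assoc, Category.id_comp]
    exact congrArg Scheme.Hom.toLRSHom this
  exact ⟨inv (discOrbitMap N) ≫ s, by rw [Category.assoc, hs, IsIso.inv_hom_id]⟩

theorem hasRationalPoint_of_hasSection (h : HasSection φ) : HasRationalPoint φ := by
  obtain ⟨s, hs⟩ := h
  exact ⟨pullback.lift (genericInclusionLRS ≫ s) (𝟙 _)
    (by rw [Category.assoc, hs, Category.comp_id, Category.id_comp]), pullback.lift_snd _ _ _⟩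

end FixedPointSection

/-! ### Projectivity -/

section Projective

attribute [local instance] MvPolynomial.gradedAlgebra

theorem bijective_algebraMap_homogeneousSubmodule_zero (n : ℕ) : Function.Bijective
    (algebraMap ℂ (MvPolynomial.homogeneousSubmodule (Fin (n + 1)) ℂ 0)) := by
  refine ⟨fun a b h => MvPolynomial.C_injective (Fin (n + 1)) ℂ (congrArg Subtype.val h),
    fun p => ?_⟩
  have hp : (p : MvPolynomial (Fin (n + 1)) ℂ).totalDegree = 0 :=
    Nat.le_zero.mp (MvPolynomial.IsHomogeneous.totalDegree_le p.2)
  exact ⟨MvPolynomial.coeff 0 (p : MvPolynomial (Fin (n + 1)) ℂ),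
    Subtype.ext (MvPolynomial.totalDegree_eq_zero_iff_eq_C.mp hp).symm⟩

instance isProper_projectiveSpace (n : ℕ) : IsProper (projectiveSpace n).hom := by
  have : IsIso (CommRingCat.ofHom
      (algebraMap ℂ (MvPolynomial.homogeneousSubmodule (Fin (n + 1)) ℂ 0))) :=
    (ConcreteCategory.isIso_iff_bijective _).mpr (bijective_algebraMap_homogeneousSubmodule_zero n)
  have : IsScalarTower ℂ (MvPolynomial.homogeneousSubmodule (Fin (n + 1)) ℂ 0)
      (MvPolynomial (Fin (n + 1)) ℂ) := ⟨fun a b c => smul_mul_assoc a (b : MvPolynomial (Fin (n + 1)) ℂ) c⟩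
  have : Algebra.FiniteType (MvPolynomial.homogeneousSubmodule (Fin (n + 1)) ℂ 0)
      (MvPolynomial (Fin (n + 1)) ℂ) := Algebra.FiniteType.of_restrictScalars_finiteType ℂ _ _
  exact inferInstanceAs (IsProper (Proj.toSpecZero _ ≫ Spec.map (CommRingCat.ofHom
      (algebraMap ℂ (MvPolynomial.homogeneousSubmodule (Fin (n + 1)) ℂ 0)))))

/-- The linear forms vanishing at a given point are a proper subspace of all linear forms, and over
the infinite field ℂ finitely many proper subspaces do not cover. Some hyperplane thus avoids all
the points, and its complement is affine. -/
theorem exists_affine_projectiveSpace {ι : Type} [Finite ι] (n : ℕ)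
    (x : ι → (projectiveSpace n).left) :
    ∃ U : (projectiveSpace n).left.Opens, IsAffineOpen U ∧ ∀ i, x i ∈ U := by
  let 𝒜 := MvPolynomial.homogeneousSubmodule (Fin (n + 1)) ℂ
  let y : ι → Proj 𝒜 := x
  let P (i : ι) : Submodule ℂ (𝒜 1) :=
    { carrier := {f | (f : MvPolynomial (Fin (n + 1)) ℂ) ∈ (y i).asHomogeneousIdeal}
      add_mem' := fun ha hb => (y i).asHomogeneousIdeal.toIdeal.add_mem ha hb
      zero_mem' := (y i).asHomogeneousIdeal.toIdeal.zero_mem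
      smul_mem' := fun c f hf => by
        change c • (f : MvPolynomial (Fin (n + 1)) ℂ) ∈ (y i).asHomogeneousIdeal.toIdeal
        rw [MvPolynomial.smul_eq_C_mul]
        exact Ideal.mul_mem_left _ _ hf }
  obtain ⟨f, hf⟩ : ∃ f : 𝒜 1, ∀ i, f ∉ P i := by
    by_contra! h
    obtain ⟨i, hi⟩ := Subspace.exists_eq_top_of_iUnion_eq_univ (p := P)
      (Set.eq_univ_of_forall fun f => Set.mem_iUnion.mpr (h f))
    -- If all linear forms vanished at a point, it would lie in no coordinate chart, but these
    -- charts cover.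
    have hcov := Proj.iSup_basicOpen_eq_top' 𝒜 (fun j : Fin (n + 1) => MvPolynomial.X j)
      (fun j => ⟨1, MvPolynomial.isHomogeneous_X ℂ j⟩) (by
        refine top_le_iff.mp fun p _ => ?_
        have hp : p ∈ Algebra.adjoin ℂ (Set.range fun j : Fin (n + 1) =>
            (MvPolynomial.X j : MvPolynomial (Fin (n + 1)) ℂ)) := by
          rw [MvPolynomial.adjoin_range_X]; trivial
        induction hp using Algebra.adjoin_induction with
        | mem p hp => exact Algebra.subset_adjoin hp
        | algebraMap r => exact Subalgebra.algebraMap_mem _ (algebraMap ℂ (𝒜 0) r)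
        | add p q _ _ hp hq => exact add_mem (hp trivial) (hq trivial)
        | mul p q _ _ hp hq => exact mul_mem (hp trivial) (hq trivial))
    obtain ⟨j, hj⟩ := Opens.mem_iSup.mp (hcov.ge (Set.mem_univ (y i)))
    refine hj ?_
    have : (⟨MvPolynomial.X j, MvPolynomial.isHomogeneous_X ℂ j⟩ : 𝒜 1) ∈ P i := hi ▸ trivial
    exact this
  exact ⟨Proj.basicOpen 𝒜 (f : MvPolynomial (Fin (n + 1)) ℂ),
    Proj.isAffineOpen_basicOpen 𝒜 _ f.2 one_pos, hf⟩

end Projective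

section ProjectiveSurface

variable {X : ComplexScheme}

theorem IsProjectiveK3Surface.isProper (hX : IsProjectiveK3Surface X) : IsProper X.hom := by
  obtain ⟨n, i, hi⟩ := hX.projective
  rw [← Over.w i]
  infer_instance

theorem IsProjectiveK3Surface.exists_affine {ι : Type} [Finite ι] (hX : IsProjectiveK3Surface X)
    (x : ι → X.left) : ∃ U : X.left.Opens, IsAffineOpen U ∧ ∀ j, x j ∈ U := by
  obtain ⟨n, i, hi⟩ := hX.projective
  obtain ⟨U, hU, hx⟩ := exists_affine_projectiveSpace n fun j => i.left (x j)
  exact ⟨i.left ⁻¹ᵁ U, hU.preimage i.left, hx⟩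

/-- An affine open containing the orbit of x is intersected with its translates; the intersection
stays affine because X is separated. -/
theorem IsProjectiveK3Surface.exists_stable_affine {G : Type} [Group G] [Finite G]
    (hX : IsProjectiveK3Surface X) (φ : G →* Aut X) (x : X.left) :
    ∃ U : X.left.Opens, IsAffineOpen U ∧ x ∈ U ∧ ∀ g, (φ g).hom.left ⁻¹ᵁ U = U := by
  obtain ⟨U, hU, hx⟩ := hX.exists_affine fun g : G => (φ g).hom.left x
  have := hX.isProper
  have : X.left.IsSeparated := ⟨by
    rw [← terminal.comp_from X.hom]
    infer_instance⟩
  have (g : G) : IsIso (φ g).hom.left :=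
    ((Over.forget _).mapIso (φ g)).isIso_hom
  have hmem (y : X.left) : y ∈ ⨅ g, (φ g).hom.left ⁻¹ᵁ U ↔ ∀ g, (φ g).hom.left y ∈ U := by
    rw [← SetLike.mem_coe, Opens.coe_iInf, Set.mem_iInter]
    rfl
  refine ⟨⨅ g, (φ g).hom.left ⁻¹ᵁ U, ?_, ?_, fun g => ?_⟩
  · exact IsAffineOpen.iInf fun g => hU.preimage _
  · exact (hmem x).mpr hx
  · ext y
    refine (hmem _).trans (Iff.trans ?_ (hmem y).symm)
    have key (h : G) : (φ h).hom.left ((φ g).hom.left y) = (φ (h * g)).hom.left y := by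
      rw [map_mul]
      rfl
    simp only [key]
    exact ⟨fun h k => by simpa using h (k * g⁻¹), fun h k => h _⟩

end ProjectiveSurface

/-! ### Kummer descent for ring homomorphisms -/

section Kummer

variable {N : ℕ} [NeZero N] {B L I : Type} [CommRing B] [Algebra ℂ B] [Field L]
  [CommRing I] {α : CyclicGroup N →* (B →ₐ[ℂ] B)} {τ : B} {j : I →+* B}

theorem sum_stdAddChar_pow {i : ℕ} (h0 : 0 < i) (hi : i < N) :
    ∑ g : CyclicGroup N, (ZMod.stdAddChar g.toAdd : ℂ) ^ i = 0 := by
  have h1 := AddChar.sum_mulShift (R := ZMod N) (i : ZMod N) (ZMod.isPrimitive_stdAddChar N)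
  rw [if_neg fun h => (Nat.le_of_dvd h0 ((ZMod.natCast_eq_zero_iff i N).mp h)).not_gt hi,
    Nat.cast_zero] at h1
  refine Eq.trans (Fintype.sum_equiv Multiplicative.toAdd _ _ fun g => ?_) h1
  rw [← AddChar.map_nsmul_eq_pow, nsmul_eq_mul, mul_comm]

theorem sum_range_stdAddChar_pow (g : CyclicGroup N) :
    ∑ i ∈ Finset.range N, (ZMod.stdAddChar g.toAdd : ℂ) ^ i = if g = 1 then (N : ℂ) else 0 := by
  split_ifs with hg
  · simp [hg]
  · have hne : (ZMod.stdAddChar g.toAdd : ℂ) ≠ 1 := fun h => hg (by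
      rw [← AddChar.map_zero_eq_one (ZMod.stdAddChar (N := N))] at h
      exact toAdd_eq_zero.mp (ZMod.injective_stdAddChar h))
    apply mul_right_cancel₀ (sub_ne_zero.mpr hne)
    rw [geom_sum_mul, ← AddChar.map_nsmul_eq_pow, nsmul_eq_mul, CharP.cast_eq_zero, zero_mul,
      AddChar.map_zero_eq_one, sub_self, zero_mul]

/-- Averaging over the group. -/
theorem exists_average (hj : Function.Injective j) (hjα : ∀ g a, α g (j a) = j a)
    (hsurj : ∀ b, (∀ g, α g b = b) → ∃ a, j a = b) :
    ∃ q : B →+ I, (∀ b, j (q b) = (N : ℂ)⁻¹ • ∑ g, α g b) ∧ ∀ a b, q (j a * b) = a * q b := by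
  have h (b : B) : ∃ a, j a = (N : ℂ)⁻¹ • ∑ g, α g b := by
    refine hsurj _ fun g => ?_
    rw [map_smul, map_sum]
    congr 1
    refine Fintype.sum_equiv (Equiv.mulLeft g) _ _ fun h => ?_
    rw [Equiv.coe_mulLeft, map_mul]
    rfl
  choose q hq using h
  refine ⟨⟨⟨q, hj ?_⟩, fun a b => hj ?_⟩, hq, fun a b => hj ?_⟩
  · simp [hq]
  · simp [hq, Finset.sum_add_distrib]
  · simp [hq, hjα, ← Finset.mul_sum]

/-- The i-th summand is τ^N times the component of b on which g acts by the inverse of the i-th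
power of the character of τ, and these components add up to b. The factor τ^N avoids dividing by τ,
which need not be a unit of B. -/
theorem pow_mul_eq_sum {q : B → I} (hτ : ∀ g, α g τ = (ZMod.stdAddChar g.toAdd : ℂ) • τ)
    (hq : ∀ b, j (q b) = (N : ℂ)⁻¹ • ∑ g, α g b) (b : B) :
    τ ^ N * b = ∑ i ∈ Finset.range N, τ ^ (N - i) * j (q (τ ^ i * b)) := by
  have hN : (N : ℂ) ≠ 0 := Nat.cast_ne_zero.mpr (NeZero.ne N)
  have h1 (i : ℕ) (hi : i ∈ Finset.range N) : τ ^ (N - i) * j (q (τ ^ i * b)) =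
      τ ^ N * ((N : ℂ)⁻¹ • ∑ g, (ZMod.stdAddChar g.toAdd : ℂ) ^ i • α g b) := by
    have hpow : τ ^ N = τ ^ (N - i) * τ ^ i := by
      rw [← pow_add, Nat.sub_add_cancel (Finset.mem_range.mp hi).le]
    rw [hq, hpow]
    simp only [map_mul, map_pow, hτ, smul_pow, smul_mul_assoc, ← mul_smul_comm, ← Finset.mul_sum]
    simp only [mul_smul_comm, mul_assoc]
  rw [Finset.sum_congr rfl h1, ← Finset.mul_sum, ← Finset.smul_sum, Finset.sum_comm]
  simp only [← Finset.sum_smul, sum_range_stdAddChar_pow, ite_smul, zero_smul]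
  rw [Finset.sum_ite_eq' Finset.univ, if_pos (Finset.mem_univ _), map_one, smul_smul,
    inv_mul_cancel₀ hN, one_smul]
  rfl

/-- A homomorphism on the invariants extends to the whole ring once the value at a
Kummer generator is prescribed. -/
theorem exists_extend (hj : Function.Injective j) (hjα : ∀ g a, α g (j a) = j a)
    (hsurj : ∀ b, (∀ g, α g b = b) → ∃ a, j a = b)
    (hτ : ∀ g, α g τ = (ZMod.stdAddChar g.toAdd : ℂ) • τ) (χ : I →+* L) {z : L} (hz : z ≠ 0)
    (hχ : ∀ a, j a = τ ^ N → χ a = z ^ N) :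
    ∃ ψ : B →+* L, ψ τ = z ∧ ∀ a, ψ (j a) = χ a := by
  obtain ⟨q, hq, hql⟩ := exists_average hj hjα hsurj
  obtain ⟨t, ht⟩ : ∃ t, j t = τ ^ N := hsurj _ fun g => by
    rw [map_pow, hτ, smul_pow, ← AddChar.map_nsmul_eq_pow, nsmul_eq_mul, CharP.cast_eq_zero,
      zero_mul, AddChar.map_zero_eq_one, one_smul]
  have hzN : z ^ N ≠ 0 := pow_ne_zero _ hz
  -- Averaging τ^i b isolates the isotypic component of b that τ^i makes invariant; χ is applied
  -- there and the factor τ^i is divided out again as z^i.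
  let F (b : B) (i : ℕ) : L := (z ^ i)⁻¹ * χ (q (τ ^ i * b))
  let ψ (b : B) : L := ∑ i ∈ Finset.range N, F b i
  have hF (b : B) : F b N = F b 0 := by
    simp only [F]
    rw [← ht, hql, map_mul, hχ t ht, pow_zero, pow_zero, one_mul, inv_one, one_mul,
      inv_mul_cancel_left₀ hzN]
  have hadd (b c : B) : ψ (b + c) = ψ b + ψ c := by
    simp only [ψ, F, mul_add, map_add, Finset.sum_add_distrib]
  have hI (a : I) (b : B) : ψ (j a * b) = χ a * ψ b := by
    simp only [ψ, F, Finset.mul_sum]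
    refine Finset.sum_congr rfl fun i _ => ?_
    rw [mul_left_comm (τ ^ i), hql, map_mul, mul_left_comm]
  -- Multiplying b by τ shifts the index i, and by `hF` the shifted sum runs over a full period.
  have hτψ (b : B) : ψ (τ * b) = z * ψ b := by
    have h1 : ψ (τ * b) = z * ∑ i ∈ Finset.range N, F b (i + 1) := by
      simp only [ψ, F, Finset.mul_sum]
      refine Finset.sum_congr rfl fun i _ => ?_
      rw [← mul_assoc (τ ^ i), ← pow_succ, pow_succ z]
      field_simp
    have h2 := Finset.sum_range_succ (F b) N
    rw [Finset.sum_range_succ', hF] at h2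
    rw [h1, add_right_cancel h2]
  have hτψ' (n : ℕ) (b : B) : ψ (τ ^ n * b) = z ^ n * ψ b := by
    induction n with
    | zero => simp
    | succ n ih => rw [pow_succ', mul_assoc, hτψ, ih, pow_succ', mul_assoc]
  have hzero : ψ 0 = 0 := by simp [ψ, F]
  have hsum (s : Finset ℕ) (f : ℕ → B) : ψ (∑ i ∈ s, f i) = ∑ i ∈ s, ψ (f i) :=
    map_sum (⟨⟨ψ, hzero⟩, hadd⟩ : B →+ L) f s
  have hmul (b c : B) : ψ (b * c) = ψ b * ψ c := by
    -- Since z^N is nonzero, b may be replaced by τ^N b, a sum of powers of τ times invariants, for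
    -- which multiplicativity is already known.
    apply mul_left_cancel₀ hzN
    rw [← hτψ', ← mul_assoc, pow_mul_eq_sum hτ hq, Finset.sum_mul, hsum, ← mul_assoc]
    have hb (y : L) : z ^ N * ψ b * y = ∑ i ∈ Finset.range N, z ^ N * F b i * y := by
      rw [Finset.mul_sum, Finset.sum_mul]
    rw [hb]
    refine Finset.sum_congr rfl fun i hi => ?_
    have hi' : i ≤ N := (Finset.mem_range.mp hi).le
    rw [mul_assoc, hτψ', hI, ← mul_assoc, pow_sub₀ z hz hi', mul_assoc (z ^ N)]
  have hone : ψ 1 = 1 := by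
    have hq1 : q 1 = 1 := hj (by
      have : (N : ℂ) ≠ 0 := Nat.cast_ne_zero.mpr (NeZero.ne N)
      rw [hq, map_one]
      simp only [map_one, Finset.sum_const, Finset.card_univ]
      rw [← Nat.cast_smul_eq_nsmul ℂ, smul_smul]
      simp [this, ZMod.card])
    have hqi (i : ℕ) (h0 : 0 < i) (hi : i < N) : q (τ ^ i) = 0 := hj (by
      rw [hq, map_zero]
      simp only [map_pow, hτ, smul_pow]
      rw [← Finset.sum_smul, sum_stdAddChar_pow h0 hi, zero_smul, smul_zero])
    refine (Finset.sum_eq_single_of_mem 0 (Finset.mem_range.mpr (NeZero.pos N))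
      fun i hi h0 => ?_).trans ?_
    · simp only [F]
      rw [mul_one, hqi i (Nat.pos_of_ne_zero h0) (Finset.mem_range.mp hi), map_zero, mul_zero]
    · simp [F, hq1]
  refine ⟨⟨⟨⟨ψ, hone⟩, hmul⟩, hzero, hadd⟩, ?_, fun a => ?_⟩
  · exact (congrArg ψ (mul_one τ).symm).trans ((hτψ 1).trans (by rw [hone, mul_one]))
  · exact (congrArg ψ (mul_one (j a)).symm).trans ((hI a 1).trans (by rw [hone, mul_one]))

/-- A homomorphism is determined by its values at the invariants and at a Kummer generator. -/
theorem extend_unique (hj : Function.Injective j) (hjα : ∀ g a, α g (j a) = j a)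
    (hsurj : ∀ b, (∀ g, α g b = b) → ∃ a, j a = b)
    (hτ : ∀ g, α g τ = (ZMod.stdAddChar g.toAdd : ℂ) • τ) {ψ ψ' : B →+* L} (hz : ψ τ ≠ 0)
    (h : ψ τ = ψ' τ) (h' : ∀ a, ψ (j a) = ψ' (j a)) : ψ = ψ' := by
  obtain ⟨q, hq, -⟩ := exists_average hj hjα hsurj
  ext b
  -- It suffices to compare values at τ^N b, which is a polynomial in τ with invariant coefficients.
  apply mul_left_cancel₀ (pow_ne_zero N hz)
  conv_rhs => rw [h]
  rw [← map_pow, ← map_pow, ← map_mul, ← map_mul, pow_mul_eq_sum hτ hq, map_sum, map_sum]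
  simp only [map_mul, map_pow, h, h']

end Kummer

/-! ### Equivariant Laurent points specialize to fixed points -/

section LaurentPoint

variable (N : ℕ) [NeZero N]

theorem rescale_injective (g : CyclicGroup N) :
    Function.Injective (PowerSeries.rescale (ZMod.stdAddChar g.toAdd : ℂ)) := by
  have h : Function.LeftInverse (PowerSeries.rescale (ZMod.stdAddChar g⁻¹.toAdd : ℂ))
      (PowerSeries.rescale (ZMod.stdAddChar g.toAdd : ℂ)) := fun f => by
    rw [← RingHom.comp_apply, ← PowerSeries.rescale_mul, ← AddChar.map_add_eq_mul, toAdd_inv,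
      add_neg_cancel, AddChar.map_zero_eq_one, PowerSeries.rescale_one, RingHom.id_apply]
  exact h.injective

/-- The action of `ℤ/Nℤ` on `ℂ((τ))`. -/
def laurentRotation (g : CyclicGroup N) : LaurentSeries ℂ →+* LaurentSeries ℂ :=
  IsFractionRing.map (A := PowerSeries ℂ) (B := PowerSeries ℂ) (rescale_injective N g)

theorem laurentRotation_algebraMap (g : CyclicGroup N) (f : PowerSeries ℂ) :
    laurentRotation N g (algebraMap _ _ f) =
      algebraMap (PowerSeries ℂ) _ (PowerSeries.rescale (ZMod.stdAddChar g.toAdd : ℂ) f) :=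
  IsLocalization.map_eq (M := nonZeroDivisors (PowerSeries ℂ))
    (T := nonZeroDivisors (PowerSeries ℂ))
    (nonZeroDivisors_le_comap_nonZeroDivisors_of_injective _ (rescale_injective N g)) f

/-- The inclusion `ℂ((t)) → ℂ((τ))`, `t ↦ τ ^ N`. -/
def laurentExpand : LaurentSeries ℂ →+* LaurentSeries ℂ :=
  IsFractionRing.map (A := PowerSeries ℂ) (B := PowerSeries ℂ)
    (j := (PowerSeries.expand (R := ℂ) N (NeZero.ne N)).toRingHom) (expand_injective N)

theorem laurentExpand_algebraMap (f : PowerSeries ℂ) :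
    laurentExpand N (algebraMap _ _ f) =
      algebraMap (PowerSeries ℂ) _ (PowerSeries.expand (R := ℂ) N (NeZero.ne N) f) :=
  IsLocalization.map_eq (M := nonZeroDivisors (PowerSeries ℂ))
    (T := nonZeroDivisors (PowerSeries ℂ))
    (nonZeroDivisors_le_comap_nonZeroDivisors_of_injective _ (expand_injective N)) f

theorem laurentRotation_laurentExpand (g : CyclicGroup N) (f : LaurentSeries ℂ) :
    laurentRotation N g (laurentExpand N f) = laurentExpand N f := by
  have : (laurentRotation N g).comp (laurentExpand N) = laurentExpand N :=
    IsLocalization.ringHom_ext (nonZeroDivisors (PowerSeries ℂ)) <| RingHom.ext fun f => by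
      simp only [RingHom.comp_apply, laurentExpand_algebraMap, laurentRotation_algebraMap]
      rw [rescale_expand]
  exact congrArg (fun k => k f) this

/-- The closed point of the disc. -/
def discCentre : Spec (CommRingCat.of ℂ) ⟶ disc :=
  Spec.map (CommRingCat.ofHom PowerSeries.constantCoeff)

theorem discCentre_discRotation (g : CyclicGroup N) :
    discCentre ≫ discRotation N g = discCentre := by
  rw [discCentre, discRotation, ← Spec.map_comp, ← CommRingCat.ofHom_comp]
  congr 2
  ext f
  rw [RingHom.comp_apply, ← PowerSeries.coeff_zero_eq_constantCoeff_apply,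
    ← PowerSeries.coeff_zero_eq_constantCoeff_apply, PowerSeries.coeff_rescale, pow_zero, one_mul]

theorem discCentre_discToPoint : discCentre ≫ discToPoint = 𝟙 _ := by
  rw [discCentre, discToPoint, ← Spec.map_comp, ← CommRingCat.ofHom_comp, ← Spec.map_id]
  congr 2

variable {N} {X : ComplexScheme} (φ : CyclicGroup N →* Aut X)

theorem fromSpec_eq_specMap_pullFun {T : Scheme.{0}} {R : CommRingCat.{0}} (f : T ⟶ Spec R)
    {U : T.Opens} (hU : IsAffineOpen U) : hU.fromSpec ≫ f = Spec.map (pullFun f U) := by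
  rw [pullFun, Spec.map_comp, ← IsAffineOpen.SpecMap_appLE_fromSpec f (isAffineOpen_top _) hU
    (le_preimage_top f U)]
  congr 1
  rw [IsAffineOpen.fromSpec_top, Scheme.isoSpec_Spec_inv]

/-- An equivariant `ℂ((τ))`-point of a proper `X` specializes to a fixed point. -/
theorem hasFixedPoint_of_equivariant (hX : IsProper X.hom) (k : genericPoint ⟶ X.left)
    (hk : k ≫ X.hom = genericInclusion ≫ discToPoint)
    (he : ∀ g, k ≫ (φ g).hom.left =
      Spec.map (CommRingCat.ofHom (laurentRotation N g)) ≫ k) : HasFixedPoint φ := by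
  have hval : ValuativeCriterion X.hom := by
    have := IsProper.eq_valuativeCriterion ▸ hX
    exact this.1.1.1
  let S : ValuativeCommSq X.hom :=
    { R := PowerSeries ℂ, K := LaurentSeries ℂ, i₁ := k, i₂ := discToPoint, commSq := ⟨hk⟩ }
  obtain ⟨⟨l, hl₁, hl₂⟩⟩ : Nonempty S.commSq.LiftStruct := (hval.existence S).exists_lift
  change genericInclusion ≫ l = k at hl₁
  change l ≫ X.hom = discToPoint at hl₂
  have hl (g : CyclicGroup N) : discRotation N g ≫ l = l ≫ (φ g).hom.left := by
    have hrot : Spec.map (CommRingCat.ofHom (laurentRotation N g)) ≫ genericInclusion =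
        genericInclusion ≫ discRotation N g := by
      rw [genericInclusion, discRotation, ← Spec.map_comp, ← Spec.map_comp,
        ← CommRingCat.ofHom_comp, ← CommRingCat.ofHom_comp]
      congr 2
      ext1 f
      exact laurentRotation_algebraMap N g f
    have hw : (φ g).hom.left ≫ X.hom = X.hom := Over.w _
    -- Rotating the lift and moving it by g give two lifts of the same square, so they coincide by
    -- separatedness.
    let S' : ValuativeCommSq X.hom :=
      { R := PowerSeries ℂ, K := LaurentSeries ℂ, i₁ := k ≫ (φ g).hom.left, i₂ := discToPoint
        commSq := ⟨by rw [Category.assoc, hw]; exact hk⟩ }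
    have := hval.uniqueness S'
    have h := Subsingleton.elim
      (⟨discRotation N g ≫ l, by
          change genericInclusion ≫ discRotation N g ≫ l = k ≫ (φ g).hom.left
          rw [he, ← hl₁, ← Category.assoc, ← hrot, Category.assoc], by
          change (discRotation N g ≫ l) ≫ X.hom = discToPoint
          rw [Category.assoc, hl₂, discRotation_discToPoint]⟩ : S'.commSq.LiftStruct)
      ⟨l ≫ (φ g).hom.left, by
          change genericInclusion ≫ l ≫ (φ g).hom.left = k ≫ (φ g).hom.left
          rw [← hl₁, Category.assoc], by
          change (l ≫ (φ g).hom.left) ≫ X.hom = discToPoint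
          rw [Category.assoc, hw, hl₂]⟩
    exact congrArg CommSq.LiftStruct.l h
  refine ⟨Over.homMk (discCentre ≫ l) ?_, fun g => ?_⟩
  · change (discCentre ≫ l) ≫ X.hom = 𝟙 _
    rw [Category.assoc, hl₂, discCentre_discToPoint]
  · ext1
    change (discCentre ≫ l) ≫ (φ g).hom.left = discCentre ≫ l
    rw [Category.assoc, ← hl, ← Category.assoc, discCentre_discRotation]

/-- The equivariant point is Spec of ψ followed by the inclusion of U. -/
theorem hasFixedPoint_of_ringHom (hX : IsProper X.hom) {U : X.left.Opens} (hU : IsAffineOpen U)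
    (hs : ∀ g, U ≤ (φ g).hom.left ⁻¹ᵁ U) (ψ : Γ(X.left, U) ⟶ CommRingCat.of (LaurentSeries ℂ))
    (hψ : pullFun X.hom U ≫ ψ = CommRingCat.ofHom (algebraMap ℂ (PowerSeries ℂ)) ≫
      CommRingCat.ofHom (algebraMap (PowerSeries ℂ) (LaurentSeries ℂ)))
    (he : ∀ g, (φ g).hom.left.appLE U U (hs g) ≫ ψ =
      ψ ≫ CommRingCat.ofHom (laurentRotation N g)) : HasFixedPoint φ := by
  refine hasFixedPoint_of_equivariant φ hX (Spec.map ψ ≫ hU.fromSpec) ?_ fun g => ?_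
  · rw [Category.assoc, fromSpec_eq_specMap_pullFun, ← Spec.map_comp, hψ, Spec.map_comp]
    rfl
  · rw [Category.assoc, ← IsAffineOpen.SpecMap_appLE_fromSpec _ hU hU (hs g), ← Category.assoc,
      ← Category.assoc, ← Spec.map_comp, ← Spec.map_comp, he]

end LaurentPoint

/-! ### From a rational point to a fixed point -/

section RationalPoint

/-- The pullback of power series along a morphism of locally ringed spaces to the disc. -/
def lrsPullFun {T : LocallyRingedSpace.{0}} (f : T ⟶ base) (W : Opens T) :
    CommRingCat.of (PowerSeries ℂ) ⟶ T.presheaf.obj (op W) :=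
  (Scheme.ΓSpecIso (CommRingCat.of (PowerSeries ℂ))).inv ≫ f.c.app (op ⊤) ≫
    T.presheaf.map (homOfLE (show W ≤ (Opens.map f.base).obj ⊤ from le_top)).op

theorem lrsPullFun_app {T T' : LocallyRingedSpace.{0}} (f : T ⟶ base) (h : T' ⟶ T) (W : Opens T) :
    lrsPullFun f W ≫ h.c.app (op W) = lrsPullFun (h ≫ f) ((Opens.map h.base).obj W) := by
  simp only [lrsPullFun, Category.assoc]
  rw [h.c.naturality]
  rfl

theorem lrsPullFun_map {T : LocallyRingedSpace.{0}} (f : T ⟶ base) {W W' : Opens T} (h : W' ≤ W) :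
    lrsPullFun f W ≫ T.presheaf.map (homOfLE h).op = lrsPullFun f W' := by
  simp only [lrsPullFun, Category.assoc]
  rw [← T.presheaf.map_comp]
  rfl

/-- A point landing in V evaluates functions on V; lying over the generic point of the base, it
sends each power series in t to itself. -/
theorem exists_evaluation {T : LocallyRingedSpace.{0}} (π : T ⟶ base)
    (p : genericPoint.toLocallyRingedSpace ⟶ T) (hp : p ≫ π = genericInclusionLRS) (V : Opens T)
    (hV : ⊤ ≤ (Opens.map p.base).obj V) :
    ∃ χ : T.presheaf.obj (op V) ⟶ CommRingCat.of (LaurentSeries ℂ), ∀ f : PowerSeries ℂ,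
      χ.hom ((lrsPullFun π V).hom f) = algebraMap (PowerSeries ℂ) (LaurentSeries ℂ) f := by
  refine ⟨p.c.app (op V) ≫ genericPoint.presheaf.map (homOfLE hV).op ≫
    (Scheme.ΓSpecIso (CommRingCat.of (LaurentSeries ℂ))).hom, fun f => ?_⟩
  have h1 : lrsPullFun π V ≫ p.c.app (op V) ≫ genericPoint.presheaf.map (homOfLE hV).op =
      lrsPullFun genericInclusionLRS ⊤ := by
    rw [← Category.assoc, lrsPullFun_app]
    erw [lrsPullFun_map]
    rw [hp]
  have h2 : lrsPullFun genericInclusionLRS ⊤ ≫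
      (Scheme.ΓSpecIso (CommRingCat.of (LaurentSeries ℂ))).hom =
      CommRingCat.ofHom (algebraMap (PowerSeries ℂ) (LaurentSeries ℂ)) := by
    rw [← Iso.eq_comp_inv, Scheme.ΓSpecIso_inv_naturality]
    refine congrArg ((Scheme.ΓSpecIso (CommRingCat.of (PowerSeries ℂ))).inv ≫ ·) ?_
    exact (congrArg (genericInclusion.app ⊤ ≫ ·) (genericPoint.presheaf.map_id _)).trans
      (Category.comp_id _)
  have h3 := congrArg (· ≫ (Scheme.ΓSpecIso (CommRingCat.of (LaurentSeries ℂ))).hom) h1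
  exact ConcreteCategory.congr_hom (h3.trans h2) f

variable {N : ℕ} [NeZero N] {X : ComplexScheme} (φ : CyclicGroup N →* Aut X)

theorem diagonalMap_fst (g : CyclicGroup N) : diagonalMap φ g ≫ pullback.fst X.hom discToPoint =
    pullback.fst X.hom discToPoint ≫ (φ g).hom.left :=
  pullback.lift_fst _ _ _

theorem diagonalMap_snd (g : CyclicGroup N) : diagonalMap φ g ≫ pullback.snd X.hom discToPoint =
    pullback.snd X.hom discToPoint ≫ discRotation N g :=
  pullback.lift_snd _ _ _

/-- Power series as functions on `X × Δ₂`. -/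
abbrev discFun (W : (productWithDisc X).Opens) :
    CommRingCat.of (PowerSeries ℂ) ⟶ Γ(productWithDisc X, W) :=
  pullFun (pullback.snd X.hom discToPoint) W

instance productSectionsAlgebra (W : (productWithDisc X).Opens) :
    Algebra ℂ Γ(productWithDisc X, W) :=
  ((discFun W).hom.comp (algebraMap ℂ (PowerSeries ℂ))).toAlgebra

theorem discFun_diagonalMap {W : (productWithDisc X).Opens} (g : CyclicGroup N)
    (h : W ≤ diagonalMap φ g ⁻¹ᵁ W) (f : PowerSeries ℂ) :
    ((diagonalMap φ g).appLE W W h).hom ((discFun W).hom f) =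
      (discFun W).hom (PowerSeries.rescale (ZMod.stdAddChar g.toAdd) f) := by
  have h1 : discFun W ≫ (diagonalMap φ g).appLE W W h =
      CommRingCat.ofHom (PowerSeries.rescale (ZMod.stdAddChar g.toAdd)) ≫ discFun W := by
    rw [pullFun_appLE, diagonalMap_snd, discRotation, pullFun_specMap]
  exact ConcreteCategory.congr_hom h1 f

theorem rescale_algebraMap (a c : ℂ) : PowerSeries.rescale a (algebraMap ℂ (PowerSeries ℂ) c) =
    algebraMap ℂ (PowerSeries ℂ) c := by
  ext n
  simp only [PowerSeries.algebraMap_apply, PowerSeries.coeff_rescale, PowerSeries.coeff_C]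
  split_ifs with h <;> simp [h]

/-- The action of `G` on the functions on a stable open subset of `X × Δ₂`. -/
def sectionsAction {W : (productWithDisc X).Opens} (hW : ∀ g, W ≤ diagonalMap φ g ⁻¹ᵁ W) :
    CyclicGroup N →* (Γ(productWithDisc X, W) →ₐ[ℂ] Γ(productWithDisc X, W)) where
  toFun g :=
    { __ := ((diagonalMap φ g).appLE W W (hW g)).hom
      commutes' := fun c => (discFun_diagonalMap φ g (hW g) _).trans
        (congrArg (discFun W).hom (rescale_algebraMap _ c)) }
  map_one' := by
    ext s
    change ((diagonalMap φ 1).appLE W W (hW 1)).hom s = s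
    refine (map_app_of_eq (congrArg Scheme.Hom.toLRSHom (diagonalMap_one φ)) W (hW 1) s).trans ?_
    rfl
  map_mul' g h := by
    ext s
    change ((diagonalMap φ (g * h)).appLE W W (hW (g * h))).hom s =
      ((diagonalMap φ g).appLE W W (hW g)).hom (((diagonalMap φ h).appLE W W (hW h)).hom s)
    rw [← CommRingCat.comp_apply, Scheme.Hom.appLE_comp_appLE]
    -- Pulling back functions reverses composition; commutativity of G makes it a left action all
    -- the same.
    have hc : diagonalMap φ (g * h) = diagonalMap φ g ≫ diagonalMap φ h := by
      rw [mul_comm, diagonalMap_mul]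
    congr 2
    simp only [hc]

theorem sectionsAction_discFun {W : (productWithDisc X).Opens}
    (hW : ∀ g, W ≤ diagonalMap φ g ⁻¹ᵁ W) (g : CyclicGroup N) (f : PowerSeries ℂ) :
    sectionsAction φ hW g ((discFun W).hom f) =
      (discFun W).hom (PowerSeries.rescale (ZMod.stdAddChar g.toAdd) f) :=
  discFun_diagonalMap φ g (hW g) f

/-- A homomorphism to `ℂ((t))` from the invariant functions on a stable open subset of `X × Δ₂`
extends to an equivariant homomorphism to `ℂ((τ))` from all functions. -/
theorem exists_equivariant {W : (productWithDisc X).Opens}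
    (hW : ∀ g, W ≤ diagonalMap φ g ⁻¹ᵁ W) {I : Type} [CommRing I]
    (j : I →+* Γ(productWithDisc X, W)) (hj : Function.Injective j)
    (hjα : ∀ g a, sectionsAction φ hW g (j a) = j a)
    (hsurj : ∀ b, (∀ g, sectionsAction φ hW g b = b) → ∃ a, j a = b)
    (χ : I →+* LaurentSeries ℂ) (hχ : ∀ a f,
      j a = (discFun W).hom (PowerSeries.expand (R := ℂ) N (NeZero.ne N) f) →
      χ a = algebraMap (PowerSeries ℂ) (LaurentSeries ℂ) f) :
    ∃ ψ : Γ(productWithDisc X, W) →+* LaurentSeries ℂ,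
      (∀ c : ℂ, ψ ((discFun W).hom (algebraMap ℂ (PowerSeries ℂ) c)) =
        algebraMap (PowerSeries ℂ) (LaurentSeries ℂ) (algebraMap ℂ (PowerSeries ℂ) c)) ∧
      ∀ g b, ψ (sectionsAction φ hW g b) = laurentRotation N g (ψ b) := by
  let τ : Γ(productWithDisc X, W) := (discFun W).hom PowerSeries.X
  have hτ (g) : sectionsAction φ hW g τ = (ZMod.stdAddChar g.toAdd : ℂ) • τ := by
    rw [sectionsAction_discFun, PowerSeries.rescale_X, map_mul]
    rfl
  have hχj (a) (f : PowerSeries ℂ) (ha : j a = (discFun W).hom f) (hf : ∀ g : ZMod N,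
      PowerSeries.rescale (ZMod.stdAddChar g) f = f) :
      laurentExpand N (χ a) = algebraMap (PowerSeries ℂ) (LaurentSeries ℂ) f := by
    obtain ⟨f, rfl⟩ := (mem_range_expand_iff N f).mpr hf
    rw [hχ a f ha, laurentExpand_algebraMap]
  let z : LaurentSeries ℂ := algebraMap (PowerSeries ℂ) (LaurentSeries ℂ) PowerSeries.X
  have hz : z ≠ 0 := fun h => PowerSeries.X_ne_zero
    (IsFractionRing.injective (PowerSeries ℂ) (LaurentSeries ℂ) (h.trans (map_zero _).symm))
  have hXN (g : ZMod N) : PowerSeries.rescale (ZMod.stdAddChar g)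
      (PowerSeries.X ^ N : PowerSeries ℂ) = PowerSeries.X ^ N := by
    rw [← PowerSeries.expand_X N (NeZero.ne N), rescale_expand]
  -- The target is ℂ((τ)), containing ℂ((t)) through t ↦ τ^N, and the function τ is sent to the
  -- uniformizer z = τ.
  obtain ⟨ψ, hψτ, hψj⟩ := exists_extend hj hjα hsurj hτ ((laurentExpand N).comp χ) hz
    fun a ha => (hχj a _ (ha.trans (map_pow _ _ _).symm) hXN).trans (map_pow _ _ _)
  have hψC (c : ℂ) : ψ ((discFun W).hom (algebraMap ℂ (PowerSeries ℂ) c)) =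
      algebraMap (PowerSeries ℂ) (LaurentSeries ℂ) (algebraMap ℂ (PowerSeries ℂ) c) := by
    obtain ⟨a, ha⟩ := hsurj ((discFun W).hom (algebraMap ℂ (PowerSeries ℂ) c)) fun g => by
      rw [sectionsAction_discFun, rescale_algebraMap]
    rw [← ha, hψj]
    exact hχj a _ ha fun g => rescale_algebraMap _ c
  refine ⟨ψ, hψC, fun g => RingHom.congr_fun (f := ψ.comp (sectionsAction φ hW g).toRingHom)
    (g := (laurentRotation N g).comp ψ) ?_⟩
  have h1 : ψ (sectionsAction φ hW g τ) = laurentRotation N g z := by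
    rw [sectionsAction_discFun, PowerSeries.rescale_X, map_mul, map_mul]
    refine (congrArg₂ (· * ·) (hψC _) hψτ).trans ?_
    rw [laurentRotation_algebraMap, PowerSeries.rescale_X, map_mul]
    rfl
  -- Acting by g before ψ or rotating after it gives two extensions that agree on invariants and at
  -- τ, which both multiply by the same root of unity.
  refine extend_unique hj hjα hsurj hτ ?_ ?_ fun a => ?_
  · change ψ (sectionsAction φ hW g τ) ≠ 0
    rw [h1]
    exact (map_ne_zero _).mpr hz
  · change ψ (sectionsAction φ hW g τ) = laurentRotation N g (ψ τ)
    rw [h1, hψτ]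
  · change ψ (sectionsAction φ hW g (j a)) = laurentRotation N g (ψ (j a))
    rw [hjα, hψj, RingHom.comp_apply, laurentRotation_laurentExpand]

theorem lrsPullFun_totalQuotient (V : Opens (totalSpace φ)) :
    lrsPullFun (familyMap φ) V ≫ (totalQuotient φ).c.app (op V) =
      CommRingCat.ofHom (PowerSeries.expand (R := ℂ) N (NeZero.ne N)).toRingHom ≫
        discFun ((Opens.map (totalQuotient φ).base).obj V) := by
  rw [lrsPullFun_app, totalQuotient_familyMap, ← pullFun_specMap]
  rfl

theorem totalQuotient_app_lrsPullFun (V : Opens (totalSpace φ)) (f : PowerSeries ℂ) :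
    ((totalQuotient φ).c.app (op V)).hom ((lrsPullFun (familyMap φ) V).hom f) =
      (discFun ((Opens.map (totalQuotient φ).base).obj V)).hom
        (PowerSeries.expand (R := ℂ) N (NeZero.ne N) f) := by
  have h := congrArg (fun k => k.hom f) (lrsPullFun_totalQuotient φ V)
  simp only [CommRingCat.hom_comp, RingHom.comp_apply] at h
  exact h

theorem totalQuotient_app_injective (V : Opens (totalSpace φ)) :
    Function.Injective ((totalQuotient φ).c.app (op V)).hom :=
  (orbitMap_sections (diagonalAction φ) V).1

theorem sectionsAction_totalQuotient (V : Opens (totalSpace φ)) (hW : ∀ g : CyclicGroup N,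
      (Opens.map (totalQuotient φ).base).obj V ≤
        diagonalMap φ g ⁻¹ᵁ (Opens.map (totalQuotient φ).base).obj V)
    (g : CyclicGroup N) (a : (totalSpace φ).presheaf.obj (op V)) :
    sectionsAction φ hW g (((totalQuotient φ).c.app (op V)).hom a) =
      ((totalQuotient φ).c.app (op V)).hom a :=
  map_app_of_eq (diagonalMap_totalQuotient φ g) V (hW g) a

theorem exists_totalQuotient_app_eq (V : Opens (totalSpace φ)) (hW : ∀ g : CyclicGroup N,
      (Opens.map (totalQuotient φ).base).obj V ≤
        diagonalMap φ g ⁻¹ᵁ (Opens.map (totalQuotient φ).base).obj V)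
    (b : Γ(productWithDisc X, (Opens.map (totalQuotient φ).base).obj V))
    (hb : ∀ g, sectionsAction φ hW g b = b) :
    ∃ a, ((totalQuotient φ).c.app (op V)).hom a = b :=
  (orbitMap_sections (diagonalAction φ) V).2 b fun g _ => hb g

/-- For a stable affine U around the X-coordinate of a preimage of q, the open set U × Δ₂ is stable
and so descends to the quotient. -/
theorem exists_stable_nhd (hX : IsProjectiveK3Surface X) (q : totalSpace φ) :
    ∃ (U : X.left.Opens) (V : Opens (totalSpace φ)), IsAffineOpen U ∧ q ∈ V ∧
      (∀ g, (φ g).hom.left ⁻¹ᵁ U = U) ∧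
      (Opens.map (totalQuotient φ).base).obj V = pullback.fst X.hom discToPoint ⁻¹ᵁ U := by
  obtain ⟨y, rfl⟩ := orbitMap_surjective (diagonalAction φ) q
  obtain ⟨U, hU, hyU, hst⟩ := hX.exists_stable_affine φ (pullback.fst X.hom discToPoint y)
  obtain ⟨V, hV⟩ := exists_preimage_orbitMap (diagonalAction φ)
    (pullback.fst X.hom discToPoint ⁻¹ᵁ U) fun g y => by
      have h1 : diagonalMap φ g ⁻¹ᵁ pullback.fst X.hom discToPoint ⁻¹ᵁ U =
          pullback.fst X.hom discToPoint ⁻¹ᵁ U := by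
        rw [← Scheme.Hom.comp_preimage, diagonalMap_fst, Scheme.Hom.comp_preimage, hst]
      exact Iff.of_eq (congrArg (y ∈ ·) h1)
  have hy : y ∈ (Opens.map (orbitMap (diagonalAction φ)).base).obj V := hV ▸ hyU
  exact ⟨U, V, hU, hy, hst, hV⟩

theorem hasFixedPoint_of_hasRationalPoint (hX : IsProjectiveK3Surface X)
    (h : HasRationalPoint φ) : HasFixedPoint φ := by
  obtain ⟨p₀, hp₀⟩ := h
  obtain ⟨p, hp⟩ : ∃ p : genericPoint.toLocallyRingedSpace ⟶ totalSpace φ,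
      p ≫ familyMap φ = genericInclusionLRS :=
    ⟨p₀ ≫ (pullback.fst (familyMap φ) genericInclusionLRS : genericFibre φ ⟶ _),
      (Category.assoc _ _ _).trans <| (congrArg (p₀ ≫ ·) pullback.condition).trans <|
        (Category.assoc _ _ _).symm.trans <|
          (congrArg (· ≫ genericInclusionLRS) hp₀).trans (Category.id_comp _)⟩
  let η : PrimeSpectrum (LaurentSeries ℂ) := ⊥
  obtain ⟨U, V, hU, hq, hst, hV⟩ := exists_stable_nhd φ hX (p.base η)
  -- The spectrum of a field has one point, so p factors through any open neighbourhood of its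
  -- image.
  have hVtop : ⊤ ≤ (Opens.map p.base).obj V := fun z _ => by
    have hz : z = η := Subsingleton.elim (α := PrimeSpectrum (LaurentSeries ℂ)) _ _
    rw [hz]
    exact hq
  obtain ⟨χ, hχ⟩ := exists_evaluation (familyMap φ) p hp V hVtop
  have hW (g : CyclicGroup N) : (Opens.map (totalQuotient φ).base).obj V ≤
      diagonalMap φ g ⁻¹ᵁ (Opens.map (totalQuotient φ).base).obj V := by
    rw [hV, ← Scheme.Hom.comp_preimage, diagonalMap_fst, Scheme.Hom.comp_preimage, hst]
  have hj := totalQuotient_app_injective φ V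
  obtain ⟨ψ, hψC, hψ⟩ := exists_equivariant φ hW ((totalQuotient φ).c.app (op V)).hom hj
    (sectionsAction_totalQuotient φ V hW) (exists_totalQuotient_app_eq φ V hW) χ.hom
    fun a f ha => by
      rw [← hχ f, hj (ha.trans (totalQuotient_app_lrsPullFun φ V f).symm)]
  refine hasFixedPoint_of_ringHom φ hX.isProper hU (fun g => (hst g).ge)
    ((pullback.fst X.hom discToPoint).appLE U _ hV.le ≫ CommRingCat.ofHom ψ) ?_ fun g => ?_
  -- Constants on X and constants on the disc agree on the fibre product over ℂ, so ψ restricted to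
  -- Γ(U) is ℂ-linear.
  · rw [← Category.assoc, pullFun_appLE, pullback.condition]
    refine (congrArg (· ≫ CommRingCat.ofHom ψ) (pullFun_specMap _ _ _)).trans ?_
    exact CommRingCat.hom_ext (RingHom.ext hψC)
  · have h1 : CommRingCat.ofHom ψ ≫ CommRingCat.ofHom (laurentRotation N g) =
        (diagonalMap φ g).appLE _ _ (hW g) ≫ CommRingCat.ofHom ψ :=
      CommRingCat.hom_ext (RingHom.ext fun b => (hψ g b).symm)
    rw [Category.assoc, h1, ← Category.assoc, ← Category.assoc, Scheme.Hom.appLE_comp_appLE,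
      Scheme.Hom.appLE_comp_appLE]
    simp only [diagonalMap_fst]

end RationalPoint

end IsotrivialK3

end

theorem mainTheorem5 (N : ℕ) [NeZero N] (X : IsotrivialK3.ComplexScheme)
    (hX : IsotrivialK3.IsProjectiveK3Surface X)
    (φ : IsotrivialK3.CyclicGroup N →* Aut X) (hφ : Function.Injective φ) :
    (IsotrivialK3.HasSection φ ↔ IsotrivialK3.HasFixedPoint φ) ∧
      (IsotrivialK3.HasRationalPoint φ ↔ IsotrivialK3.HasFixedPoint φ) :=
  have hfix := IsotrivialK3.hasFixedPoint_of_hasRationalPoint φ hX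
  have hsec := IsotrivialK3.hasSection_of_hasFixedPoint φ
  have hrat := IsotrivialK3.hasRationalPoint_of_hasSection φ
  ⟨⟨fun h => hfix (hrat h), hsec⟩, ⟨hfix, fun h => hrat (hsec h)⟩⟩
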